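/- \textbf{Theorem (Formula for a region of type C).} \emph{Lattice and weights.} Consider the triangular lattice with coordinates $(i,j)$ such that one unit of the horizontal $i$-axis is half the length of a lattice edge, one unit of the vertical $j$-axis is the height of a unit triangle, and the origin is a lattice vertex. A lozenge is the union of two unit triangles that share an edge; it is vertical if the shared edge is horizontal. Under the weight $\mathrm{wt}_2$, a vertical lozenge with center $(i,j)$ has weight $\frac{q^{i}+q^{-i}}{2}$ if $i\neq 0$, a vertical lozenge centered on the $j$-axis ($i=0$) has weight $\frac12$, and every other lozenge has weight $1$. For a finite region $R$, $\mathrm M(R)$ is the sum, over all lozenge tilings of $R$, of the product of the weights of the lozenges of the tiling (so $\mathrm M(\emptyset)=1$). \emph{The region.} Let $x,u,n$ be non-negative integers with $n\le u$, and let $1\le h_1<h_2<\dots<h_n\le u$ be integers. Start with the halved hexagon whose north, northeast, southeast and south sides have lengths $x,\ 2u-n,\ n,\ x+u-n$ and whose west side is the vertical zigzag with $2u$ unit steps $(0,0),(-1,1),(0,2),(-1,3),\dots,(-1,2u-1),(0,2u)$; its southwest corner is the origin, so the $j$-axis passes through the centers of the vertical lozenges along the west side. For $1\le k\le u$ the $k$-th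 bump of the west side (counted from the bottom) has its tip at $(-1,2k-1)$. For every $k\in\{1,\dots,u\}\setminus\{h_1,\dots,h_n\}$ remove from the region the up-pointing unit triangle in the $k$-th bump, i.e. the one with vertices $(-1,2k-1),(1,2k-1),(0,2k)$. The resulting region, weighted by $\mathrm{wt}_2$, is $C_{x,u}(h_1,\dots,h_n)$. \emph{The product.} Put $[k]_q=1+q+\dots+q^{k-1}$, $[k]_q!=[1]_q[2]_q\cdots[k]_q$, $\left\langle{b\atop a}\right\rangle=a+(a+1)+\dots+b$ and $f(t,a,b)=\frac{ab(2t+a-b)}{2}$. For an integer $x$, non-negative integers $u,d,m,n$ with $m\le d$, $n\le u$, and sequences $1\le l_1<\dots<l_m\le d$, $1\le h_1<\dots<h_n\le u$, let $e'=\min(u-n,\,d-m+1)$, $\tilde x=x+u-n+d-m-e'$, $t_1'=2(x+u-n-e')+1$, $t_2'=2(x+d-m+1-e')$, \[E'=f(t_1'+2d-m,\,n+1,\,m)+\sum_{i=1}^m\left\langle{t_1'+2d-m-(m-i+1)\atop t_1'+2(d-l_i)-2(m-i)}\right\rangle+\sum_{i=1}^n\left\langle{t_2'+2u-n-(n-i+1)\atop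 t_2'+2(u-h_i)-2(n-i)}\right\rangle,\] \[F'=(n+1)m+\sum_{i=1}^m(2l_i-i)+\sum_{i=1}^n(2h_i-i),\] and \begin{align*} Q(x,u,d,(l_i)_{i=1}^m,(h_j)_{j=1}^n)={}&2^{-F'}q^{-E'}\,\frac{\prod_{1\le i<j\le m}[2(l_j-l_i)]_{q^2}\prod_{1\le i<j\le n}[2(h_j-h_i)]_{q^2}}{\prod_{i=1}^m\prod_{j=1}^n[2(l_i+h_j)]_{q^2}\prod_{i=1}^m[2l_i]_{q^2}!\prod_{j=1}^n[2h_j-1]_{q^2}!}\\ &\times\prod_{i=1}^{\lceil n/2\rceil}\prod_{j=1}^{2n-4i+3}[2\tilde x+2i+j]_{q^2}\\ &\times\prod_{i=1}^m[2(\tilde x+n+i)]_{q^2}[2(\tilde x+n+i+1)]_{q^2}\prod_{i=1}^m\prod_{j=1}^{n+i-1}[2\tilde x+n+i+j+1]_{q^2}\\ &\times\prod_{i=1}^n\prod_{j=1}^m\frac{[2(\tilde x+i+j-1)]_{q^2}}{[2(\tilde x+i+j-1)+1]_{q^2}}\\ &\times\prod_{i=1}^m\prod_{j=1}^{l_i-i}[2(\tilde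 x+i+j+n+1)]_{q^2}[2(\tilde x-i-j+m+1)]_{q^2}\\ &\times\prod_{i=1}^n\prod_{j=1}^{h_i-i}[2(\tilde x+i+j+m)]_{q^2}[2(\tilde x-i-j+n+2)]_{q^2}. \end{align*} \emph{Claim.} Let $q$ be an indeterminate or, more generally, a nonzero element of a field in which $2\neq0$ and $[k]_{q^2}\ne 0$ for all $k\ge1$. Then \[\mathrm M(C_{x,u}(h_1,\dots,h_n))=Q(x,u,0,\emptyset,(h_j)_{j=1}^n)\quad\text{if } n<u,\] \[\mathrm M(C_{x,u}(h_1,\dots,h_n))=Q(x-1,u,0,\emptyset,(h_j)_{j=1}^n)\quad\text{if } n=u.\] (In both cases $\tilde x=x+u-n-1$ and $t_2'=2x$.) -/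

import Mathlib

/-! ## The triangular lattice

Coordinates: one unit of the horizontal `i`-axis is half an edge of the lattice, one unit of the
vertical `j`-axis is the height of a row of unit triangles, and the origin is a lattice vertex.
The lattice vertices are the points `(i, j)` of `ℤ × ℤ` with `i + j` even.  The unit triangle in
the row between heights `j` and `j + 1` whose horizontal edge has its midpoint on the vertical
line `i = c` is encoded as `(c, j)`:
* if `c + j` is odd it is up-pointing, with vertices `(c - 1, j)`, `(c + 1, j)`, `(c, j + 1)`;
* if `c + j` is even it is down-pointing, with vertices `(c - 1, j + 1)`, `(c + 1, j + 1)`,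
  `(c, j)`. -/

/-- Unit triangles of the triangular lattice. -/
abbrev UnitTriangle : Type := ℤ × ℤ

/-- The up-pointing unit triangles. -/
def UnitTriangle.IsUp (t : UnitTriangle) : Prop := Odd (t.1 + t.2)

instance : DecidablePred UnitTriangle.IsUp := fun t =>
  inferInstanceAs (Decidable (Odd (t.1 + t.2)))

/-- A lozenge is the union of two unit triangles sharing an edge; it is given as the pair of its
up-pointing triangle `(c, j)` and its down-pointing triangle, which is the left neighbour
`(c - 1, j)`, the right neighbour `(c + 1, j)`, or the neighbour `(c, j - 1)` below. -/
def IsLozenge (L : UnitTriangle × UnitTriangle) : Prop :=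
  UnitTriangle.IsUp L.1 ∧
    (L.2 = (L.1.1 - 1, L.1.2) ∨ L.2 = (L.1.1 + 1, L.1.2) ∨ L.2 = (L.1.1, L.1.2 - 1))

instance : DecidablePred IsLozenge := fun L =>
  inferInstanceAs (Decidable (UnitTriangle.IsUp L.1 ∧
    (L.2 = (L.1.1 - 1, L.1.2) ∨ L.2 = (L.1.1 + 1, L.1.2) ∨ L.2 = (L.1.1, L.1.2 - 1))))

/-- The lozenges contained in a finite region (a finite set of unit triangles). -/
def regionLozenges (R : Finset UnitTriangle) : Finset (UnitTriangle × UnitTriangle) :=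
  (R ×ˢ R).filter IsLozenge

/-- The lozenge tilings of a region: sets of lozenges contained in the region such that every unit
triangle of the region belongs to exactly one of them. -/
def lozengeTilings (R : Finset UnitTriangle) : Finset (Finset (UnitTriangle × UnitTriangle)) :=
  (regionLozenges R).powerset.filter fun T =>
    ∀ t ∈ R, (T.filter fun L => L.1 = t ∨ L.2 = t).card = 1

/-- The weight `wt₂`.  A vertical lozenge, with upper triangle `(c, j)` and lower triangle
`(c, j - 1)`, has its center at the point `(c, j)`; its weight is `(q ^ c + q ^ (-c)) / 2`, except
that it is `1 / 2` if the lozenge is crossed by the `j`-axis (`c = 0`).  All other lozenges have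
weight `1`. -/
def wtTwo {K : Type*} [Field K] (q : K) (L : UnitTriangle × UnitTriangle) : K :=
  if L.2 = (L.1.1, L.1.2 - 1) then
    if L.1.1 = 0 then 1 / 2 else (q ^ L.1.1 + q ^ (-L.1.1)) / 2
  else 1

/-- The tiling generating function of a region, for the weight `wt₂`. -/
def tilingGF {K : Type*} [Field K] (q : K) (R : Finset UnitTriangle) : K :=
  ∑ T ∈ lozengeTilings R, ∏ L ∈ T, wtTwo q L

/-! ## The region -/

/-- The halved hexagon with north, northeast, southeast and south sides of lengths
`x, 2 * u - n, n, x + u - n` (for `n ≤ u`), placed with its southwest corner at the origin.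
With `s = 2 * (x + u - n)` its corners are `(0, 0)`, `(s, 0)`, `(s + n, n)`, `(2 * x, 2 * u)`,
`(0, 2 * u)`, and its west side is the vertical zigzag
`(0, 0), (-1, 1), (0, 2), (-1, 3), …, (-1, 2 * u - 1), (0, 2 * u)` with `2 * u` unit steps.
The triangles to the right of the zigzag are those with `0 ≤ c`, the first inequality of the
filter describes the southeast side, and the second one the northeast side. -/
noncomputable def halvedHexagon (x u n : ℕ) : Finset UnitTriangle :=
  (Finset.Icc (0 : ℤ) (2 * x + 2 * u) ×ˢ Finset.Ico (0 : ℤ) (2 * u)).filter fun t =>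
    t.1 ≤ 2 * ((x : ℤ) + u - n) + t.2 ∧ t.1 + t.2 + 1 ≤ 2 * ((x : ℤ) + u - n) + 2 * n

/-- The region `C_{x,u}(h₁, …, hₙ)`.  The bumps of the west side of the halved hexagon are
numbered `1, …, u` from bottom to top; the tip of bump `k` is the vertex `(-1, 2 * k - 1)` and
its up-pointing triangle is `(0, 2 * k - 1)`.  That triangle is removed for every `k` which is
not one of the `hᵢ`.  The `j`-axis goes through the centers of the vertical lozenges along the
west side. -/
noncomputable def typeCRegion (x u : ℕ) {n : ℕ} (h : Fin n → ℕ) : Finset UnitTriangle :=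
  halvedHexagon x u n \
    ((Finset.Icc 1 u).filter fun k => ∀ i, h i ≠ k).image fun k : ℕ => ((0 : ℤ), 2 * (k : ℤ) - 1)

/-! ## The product formula -/

/-- The `q`-integer `[k]_q = 1 + q + ⋯ + q ^ (k - 1)`, for an integer `k ≥ 0`. -/
def qInt {K : Type*} [Field K] (q : K) (k : ℤ) : K := ∑ i ∈ Finset.range k.toNat, q ^ i

/-- The `q`-factorial `[k]_q! = [1]_q [2]_q ⋯ [k]_q`. -/
def qFact {K : Type*} [Field K] (q : K) (k : ℕ) : K := ∏ i ∈ Finset.Icc 1 k, qInt q i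

/-- `⟨b; a⟩ = a + (a + 1) + ⋯ + b`. -/
noncomputable def consecSum (b a : ℤ) : ℤ := ∑ k ∈ Finset.Icc a b, k

/-- `f(t, a, b) = a b (2 t + a - b) / 2`, which is always an integer. -/
def fQ (t a b : ℤ) : ℤ := a * b * (2 * t + a - b) / 2

/-- `e' = min (u - n, d - m + 1)`. -/
noncomputable def eQ (u d m n : ℤ) : ℤ := min (u - n) (d - m + 1)

/-- The exponent `E'`; the index `i` of the text is `(i : ℤ) + 1` for `i` in `Fin m` or `Fin n`,
here and below. -/
noncomputable def expE (x : ℤ) (u d : ℕ) {m n : ℕ} (l : Fin m → ℕ) (h : Fin n → ℕ) : ℤ :=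
  let e := eQ u d m n
  let t₁ : ℤ := 2 * (x + u - n - e) + 1
  let t₂ : ℤ := 2 * (x + d - m + 1 - e)
  fQ (t₁ + 2 * d - m) (n + 1) m
    + ∑ i : Fin m, consecSum (t₁ + 2 * d - m - (m - ((i : ℤ) + 1) + 1))
        (t₁ + 2 * ((d : ℤ) - l i) - 2 * (m - ((i : ℤ) + 1)))
    + ∑ i : Fin n, consecSum (t₂ + 2 * u - n - (n - ((i : ℤ) + 1) + 1))
        (t₂ + 2 * ((u : ℤ) - h i) - 2 * (n - ((i : ℤ) + 1)))

/-- The exponent `F'`. -/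
def expF {m n : ℕ} (l : Fin m → ℕ) (h : Fin n → ℕ) : ℤ :=
  ((n : ℤ) + 1) * m + ∑ i : Fin m, (2 * (l i : ℤ) - ((i : ℤ) + 1))
    + ∑ i : Fin n, (2 * (h i : ℤ) - ((i : ℤ) + 1))

/-- The expression `Q(x, u, d, (lᵢ), (hⱼ))`, with `y = x + u - n + d - m - e'`. -/
noncomputable def qProductQ {K : Type*} [Field K] (q : K) (x : ℤ) (u d : ℕ) {m n : ℕ}
    (l : Fin m → ℕ) (h : Fin n → ℕ) : K :=
  let y : ℤ := x + u - n + d - m - eQ u d m n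
  let br : ℤ → K := qInt (q ^ 2)
  (2 : K) ^ (-expF l h) * q ^ (-expE x u d l h)
  * (((∏ i : Fin m, ∏ j ∈ Finset.Ioi i, br (2 * ((l j : ℤ) - l i)))
        * ∏ i : Fin n, ∏ j ∈ Finset.Ioi i, br (2 * ((h j : ℤ) - h i)))
      / ((∏ i : Fin m, ∏ j : Fin n, br (2 * ((l i : ℤ) + h j)))
        * (∏ i : Fin m, qFact (q ^ 2) (2 * l i)) * ∏ j : Fin n, qFact (q ^ 2) (2 * h j - 1)))
  * (∏ i ∈ Finset.Icc 1 ((n + 1) / 2), ∏ j ∈ Finset.Icc 1 (2 * n + 3 - 4 * i),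
      br (2 * y + 2 * i + j))
  * (∏ i ∈ Finset.Icc 1 m, br (2 * (y + n + i)) * br (2 * (y + n + i + 1)))
  * (∏ i ∈ Finset.Icc 1 m, ∏ j ∈ Finset.Icc 1 (n + i - 1), br (2 * y + n + i + j + 1))
  * (∏ i ∈ Finset.Icc 1 n, ∏ j ∈ Finset.Icc 1 m,
      br (2 * (y + i + j - 1)) / br (2 * (y + i + j - 1) + 1))
  * (∏ i : Fin m, ∏ j ∈ Finset.Icc 1 (l i - (i + 1)),
      br (2 * (y + ((i : ℤ) + 1) + j + n + 1)) * br (2 * (y - ((i : ℤ) + 1) - j + m + 1)))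
  * (∏ i : Fin n, ∏ j ∈ Finset.Icc 1 (h i - (i + 1)),
      br (2 * (y + ((i : ℤ) + 1) + j + m)) * br (2 * (y - ((i : ℤ) + 1) - j + n + 2)))

/-! Lozenge tilings of the region are families of `n` nonintersecting lattice paths. They start at
`(2 * (x + u - n) + i, i)` on the southeast side, step by `(-2, 0)` with weight 1 or by `(-1, 1)`
across a vertical lozenge, and end at the retained bumps `(-1, 2 * h k - 1)`. So the generating
function is a Lindström–Gessel–Viennot determinant (`tilingGF_pathRegion_eq_det`,
`tilingGF_typeCRegion_eq_det`).

No path bijection or sign-reversing involution is used. The region is swept vertex by vertex: each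
step expands the tilings along one triangle and the determinant along one row by linearity.
Colliding paths show up as equal rows.

A single path has a product formula `pathGF` in the balanced integers `balInt`, written ⟨k⟩ below,
verified through its recurrence `pathGF_rec`. With `N = x + u - n`, taking out factors that depend
only on the source or only on the sink (`pathGF_mul`) leaves entries that are products of ⟨a - X⟩
and ⟨X - b⟩ with `X = 2 * h k`. Such a determinant factors by Krattenthaler's lemma
(`det_prod_areaForm`), in a form where ⟨b - a⟩ is the area form of two plane vectors.

It remains to identify the result with the stated product. Each `q ^ 2`-integer is ⟨k⟩ times `q ^ (k
- 1)`, the products are rearranged (`prod_Icc_prod_Icc_eq`, `prod_evenFact_eq`), and the powers of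
`q` cancel by `expE_balance`. -/

/-! ### Tilings and the expansion along a triangle. -/

theorem mem_lozengeTilings {R : Finset UnitTriangle} {T : Finset (UnitTriangle × UnitTriangle)} :
    T ∈ lozengeTilings R ↔ (∀ L ∈ T, L.1 ∈ R ∧ L.2 ∈ R ∧ IsLozenge L) ∧
      ∀ t ∈ R, ∃! L, L ∈ T ∧ (L.1 = t ∨ L.2 = t) := by
  simp only [lozengeTilings, regionLozenges, Finset.mem_filter, Finset.mem_powerset,
    Finset.card_eq_one, Finset.subset_iff, Finset.mem_product, and_assoc]
  refine and_congr Iff.rfl (forall₂_congr fun t _ => ?_)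
  simp only [ExistsUnique, Finset.ext_iff, Finset.mem_filter, Finset.mem_singleton]
  constructor
  · rintro ⟨L, hL⟩
    exact ⟨L, (hL L).2 rfl, fun L' h => (hL L').1 h⟩
  · rintro ⟨L, h, hL⟩
    exact ⟨L, fun L' => ⟨hL L', fun e => e ▸ h⟩⟩

theorem erase_mem_lozengeTilings {R : Finset UnitTriangle}
    {T : Finset (UnitTriangle × UnitTriangle)} {L : UnitTriangle × UnitTriangle}
    (hT : T ∈ lozengeTilings R) (hL : L ∈ T) :
    T.erase L ∈ lozengeTilings (R \ {L.1, L.2}) := by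
  rw [mem_lozengeTilings] at hT ⊢
  obtain ⟨h1, h2⟩ := hT
  have hLR := h1 L hL
  refine ⟨fun M hM => ?_, fun t ht => ?_⟩
  · obtain ⟨hne, hM⟩ := Finset.mem_erase.1 hM
    have key : ∀ t ∈ R, (M.1 = t ∨ M.2 = t) → t ≠ L.1 ∧ t ≠ L.2 := fun t ht hMt =>
      ⟨fun e => hne ((h2 t ht).unique ⟨hM, hMt⟩ ⟨hL, Or.inl e.symm⟩),
        fun e => hne ((h2 t ht).unique ⟨hM, hMt⟩ ⟨hL, Or.inr e.symm⟩)⟩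
    obtain ⟨m1, m2, m3⟩ := h1 M hM
    simp only [Finset.mem_sdiff, Finset.mem_insert, Finset.mem_singleton, not_or]
    exact ⟨⟨m1, key _ m1 (Or.inl rfl)⟩, ⟨m2, key _ m2 (Or.inr rfl)⟩, m3⟩
  · simp only [Finset.mem_sdiff, Finset.mem_insert, Finset.mem_singleton, not_or] at ht
    obtain ⟨M, ⟨hM, hMt⟩, huniq⟩ := h2 t ht.1
    refine ⟨M, ⟨Finset.mem_erase.2 ⟨?_, hM⟩, hMt⟩,
      fun N hN => huniq N ⟨Finset.mem_of_mem_erase hN.1, hN.2⟩⟩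
    rintro rfl
    exact hMt.elim (fun e => ht.2.1 e.symm) (fun e => ht.2.2 e.symm)

theorem insert_mem_lozengeTilings {R : Finset UnitTriangle}
    {T : Finset (UnitTriangle × UnitTriangle)} {L : UnitTriangle × UnitTriangle}
    (hL : L ∈ regionLozenges R) (hT : T ∈ lozengeTilings (R \ {L.1, L.2})) :
    L ∉ T ∧ insert L T ∈ lozengeTilings R := by
  rw [mem_lozengeTilings] at hT ⊢
  simp only [regionLozenges, Finset.mem_filter, Finset.mem_product] at hL
  obtain ⟨h1, h2⟩ := hT
  simp only [Finset.mem_sdiff, Finset.mem_insert, Finset.mem_singleton, not_or] at h1 h2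
  refine ⟨fun h => (h1 L h).1.2.1 rfl, fun M hM => ?_, fun t ht => ?_⟩
  · rcases Finset.mem_insert.1 hM with rfl | hM
    · exact ⟨hL.1.1, hL.1.2, hL.2⟩
    · exact ⟨(h1 M hM).1.1, (h1 M hM).2.1.1, (h1 M hM).2.2⟩
  · by_cases htL : L.1 = t ∨ L.2 = t
    · refine ⟨L, ⟨Finset.mem_insert_self _ _, htL⟩, ?_⟩
      rintro M ⟨hM, hMt⟩
      rcases Finset.mem_insert.1 hM with rfl | hM
      · rfl
      · exfalso
        obtain ⟨⟨-, a1, a2⟩, ⟨-, b1, b2⟩, -⟩ := h1 M hM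
        rcases hMt with rfl | rfl
        · exact htL.elim (fun e => a1 e.symm) (fun e => a2 e.symm)
        · exact htL.elim (fun e => b1 e.symm) (fun e => b2 e.symm)
    · obtain ⟨M, ⟨hM, hMt⟩, hu⟩ := h2 t ⟨ht, fun e => htL (Or.inl e.symm),
        fun e => htL (Or.inr e.symm)⟩
      refine ⟨M, ⟨Finset.mem_insert_of_mem hM, hMt⟩, ?_⟩
      rintro N ⟨hN, hNt⟩
      rcases Finset.mem_insert.1 hN with rfl | hN
      · exact absurd hNt htL
      · exact hu N ⟨hN, hNt⟩

/-- Expansion of the tiling generating function along the lozenges that cover a given triangle. -/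
theorem tilingGF_expand {K : Type*} [Field K] (q : K) (R : Finset UnitTriangle)
    {t : UnitTriangle} (ht : t ∈ R) :
    tilingGF q R = ∑ L ∈ regionLozenges R with L.1 = t ∨ L.2 = t,
      wtTwo q L * tilingGF q (R \ {L.1, L.2}) := by
  have h1 : tilingGF q R = ∑ T ∈ lozengeTilings R,
      ∑ L ∈ (regionLozenges R).filter (fun L => L.1 = t ∨ L.2 = t),
        if L ∈ T then ∏ L ∈ T, wtTwo q L else 0 := by
    refine Finset.sum_congr rfl fun T hT => ?_
    obtain ⟨hT1, hT2⟩ := mem_lozengeTilings.1 hT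
    obtain ⟨L, ⟨hL, hLt⟩, hu⟩ := hT2 t ht
    rw [Finset.sum_eq_single L, if_pos hL]
    · intro M hM hne
      rw [if_neg]
      exact fun hMT => hne (hu M ⟨hMT, (Finset.mem_filter.1 hM).2⟩)
    · intro h
      refine absurd ?_ h
      have := hT1 L hL
      simp only [regionLozenges, Finset.mem_filter, Finset.mem_product]
      exact ⟨⟨⟨this.1, this.2.1⟩, this.2.2⟩, hLt⟩
  rw [h1, Finset.sum_comm]
  refine Finset.sum_congr rfl fun L hL => ?_
  obtain ⟨hL, -⟩ := Finset.mem_filter.1 hL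
  rw [← Finset.sum_filter, tilingGF, Finset.mul_sum]
  refine Finset.sum_bij' (fun T _ => T.erase L) (fun T _ => insert L T) ?_ ?_ ?_ ?_ ?_
  · intro T hT
    rw [Finset.mem_filter] at hT
    exact erase_mem_lozengeTilings hT.1 hT.2
  · intro T hT
    exact Finset.mem_filter.2 ⟨(insert_mem_lozengeTilings hL hT).2, Finset.mem_insert_self _ _⟩
  · intro T hT
    exact Finset.insert_erase (Finset.mem_filter.1 hT).2
  · intro T hT
    exact Finset.erase_insert (insert_mem_lozengeTilings hL hT).1
  · intro T hT
    exact (Finset.mul_prod_erase _ _ (Finset.mem_filter.1 hT).2).symm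

theorem tilingGF_empty {K : Type*} [Field K] (q : K) : tilingGF q ∅ = 1 := by
  simp [tilingGF, lozengeTilings, regionLozenges]

/-! ### Path regions and the Lindström–Gessel–Viennot determinant. -/

/-- The triangles met by families of lattice paths: every vertex `(c, j)` of `V` contributes the
down-pointing triangle `(c, j)`, and every vertex of `V ∪ T` that is not a source contributes the
up-pointing triangle `(c + 1, j)`. -/
def pathRegion (V T S : Finset (ℤ × ℤ)) : Finset UnitTriangle :=
  V ∪ ((V ∪ T) \ S).image fun p => (p.1 + 1, p.2)

theorem mem_pathRegion {V T S : Finset (ℤ × ℤ)} {t : UnitTriangle} :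
    t ∈ pathRegion V T S ↔
      t ∈ V ∨ (((t.1 - 1, t.2) ∈ V ∨ (t.1 - 1, t.2) ∈ T) ∧ (t.1 - 1, t.2) ∉ S) := by
  obtain ⟨a, b⟩ := t
  simp only [pathRegion, Finset.mem_union, Finset.mem_image, Finset.mem_sdiff, Prod.mk.injEq,
    Prod.exists]
  refine or_congr Iff.rfl ⟨?_, fun h => ⟨a - 1, b, h, by ring, rfl⟩⟩
  rintro ⟨a', b', h, rfl, rfl⟩
  simpa using h

/-- A vertex that is neither a source nor a sink and has no predecessors is not used by any path:
its two triangles form a lozenge. -/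
theorem tilingGF_pathRegion_erase {K : Type*} [Field K] (q : K) {V T S : Finset (ℤ × ℤ)}
    {v : ℤ × ℤ} (hV : ∀ p ∈ V, Even (p.1 + p.2)) (hT : ∀ p ∈ T, Even (p.1 + p.2))
    (hv : v ∈ V) (hvT : v ∉ T) (hvS : v ∉ S)
    (h1 : (v.1 + 2, v.2) ∉ V) (h2 : (v.1 + 1, v.2 - 1) ∉ V) :
    tilingGF q (pathRegion V T S) = tilingGF q (pathRegion (V.erase v) T S) := by
  obtain ⟨c, j⟩ := v
  have hev : Even (c + j) := hV _ hv
  have hU : ((c + 1, j) : UnitTriangle) ∈ pathRegion V T S := by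
    rw [mem_pathRegion]; right; simp [hv, hvS]
  have hD : ((c, j) : UnitTriangle) ∈ pathRegion V T S := by
    rw [mem_pathRegion]; left; exact hv
  have hdown : ∀ t : UnitTriangle, Even (t.1 + t.2) → t ∈ pathRegion V T S → t ∈ V := by
    intro t ht h
    rcases mem_pathRegion.1 h with h | ⟨h | h, -⟩
    · exact h
    · have := hV _ h; simp only at this; grind
    · have := hT _ h; simp only at this; grind
  have hfil : (regionLozenges (pathRegion V T S)).filter
      (fun L => L.1 = (c + 1, j) ∨ L.2 = (c + 1, j)) = {((c + 1, j), (c, j))} := by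
    ext ⟨L1, L2⟩
    simp only [regionLozenges, Finset.mem_filter, Finset.mem_product, Finset.mem_singleton,
      IsLozenge, UnitTriangle.IsUp]
    constructor
    · rintro ⟨⟨⟨m1, m2⟩, hup, hl⟩, rfl | rfl⟩
      · rcases hl with rfl | rfl | rfl
        · simp
        · have := hdown _ (by simp only; grind) m2
          exact absurd (by simpa [add_assoc] using this) h1
        · have := hdown _ (by simp only; grind) m2
          exact absurd this h2
      · exfalso
        simp only [Prod.ext_iff] at hl
        grind
    · rintro h
      obtain ⟨rfl, rfl⟩ := Prod.mk.injEq .. ▸ h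
      refine ⟨⟨⟨hU, hD⟩, by simp only; grind, Or.inl (by simp)⟩, Or.inl rfl⟩
  rw [tilingGF_expand q _ hU, hfil, Finset.sum_singleton]
  have hw : wtTwo q ((c + 1, j), (c, j)) = 1 := by simp [wtTwo]
  rw [hw, one_mul]
  congr 1
  ext ⟨a, b⟩
  simp only [Finset.mem_sdiff, Finset.mem_insert, Finset.mem_singleton, mem_pathRegion,
    Finset.mem_erase, Prod.mk.injEq, not_or, ne_eq]
  constructor
  · rintro ⟨h | h, h3, h4⟩
    · exact Or.inl ⟨h4, h⟩
    · refine Or.inr ⟨h.1.imp (fun h => ⟨fun e => h3 ⟨by lia, e.2⟩, h⟩) id, h.2⟩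
  · rintro (h | h)
    · refine ⟨Or.inl h.2, ?_, h.1⟩
      rintro ⟨rfl, rfl⟩
      have := hV _ h.2
      grind
    · refine ⟨Or.inr ⟨h.1.imp (fun h => h.2) id, h.2⟩, ?_, ?_⟩
      · rintro ⟨rfl, rfl⟩
        rcases h.1 with h | h
        · exact h.1 ⟨by lia, rfl⟩
        · exact hvT (by simpa using h)
      · rintro ⟨rfl, rfl⟩
        rcases h.1 with h | h
        · have := hV _ h.2; grind
        · have := hT _ h; grind

/-- A path step from the source `v` to `v'` uses the down triangle of `v` and the up triangle of
`v'`. As a source, `v` has no up triangle, so nothing of it is left, and `v'` has lost its up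
triangle, which is what being a source means. -/
theorem pathRegion_sdiff {V T S : Finset (ℤ × ℤ)} {v v' : ℤ × ℤ}
    (hV : ∀ p ∈ V, Even (p.1 + p.2)) (hT : ∀ p ∈ T, Even (p.1 + p.2))
    (hv : v ∈ V) (hvT : v ∉ T) (hvS : v ∈ S) (hv' : Even (v'.1 + v'.2)) :
    pathRegion V T S \ {(v'.1 + 1, v'.2), v} =
      pathRegion (V.erase v) T (insert v' (S.erase v)) := by
  obtain ⟨c, j⟩ := v
  obtain ⟨c', j'⟩ := v'
  have hev : Even (c + j) := hV _ hv
  ext ⟨a, b⟩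
  simp only [Finset.mem_sdiff, Finset.mem_insert, Finset.mem_singleton, mem_pathRegion,
    Finset.mem_erase, Prod.mk.injEq, not_or, ne_eq]
  constructor
  · rintro ⟨h | h, h3, h4⟩
    · exact Or.inl ⟨h4, h⟩
    · have hne : ¬ (a - 1 = c ∧ b = j) := fun e => h.2 (by rw [e.1, e.2]; exact hvS)
      exact Or.inr ⟨h.1.imp (fun h => ⟨hne, h⟩) id, fun e => h3 ⟨by lia, e.2⟩, fun e => h.2 e.2⟩
  · rintro (h | h)
    · refine ⟨Or.inl h.2, ?_, h.1⟩
      rintro ⟨rfl, rfl⟩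
      have := hV _ h.2
      grind
    · have hne : ¬ (a - 1 = c ∧ b = j) := by
        rintro ⟨rfl, rfl⟩
        rcases h.1 with h | h
        · exact h.1 ⟨rfl, rfl⟩
        · exact hvT h
      refine ⟨Or.inr ⟨h.1.imp (fun h => h.2) id, fun e => h.2.2 ⟨hne, e⟩⟩,
        fun e => h.2.1 ⟨by lia, e.2⟩, ?_⟩
      rintro ⟨rfl, rfl⟩
      rcases h.1 with h | h
      · have := hV _ h.2; grind
      · have := hT _ h; grind

/-- A path leaving its source either goes left, or goes up along a vertical lozenge. -/
theorem tilingGF_pathRegion_source {K : Type*} [Field K] (q : K) {V T S : Finset (ℤ × ℤ)}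
    {v : ℤ × ℤ} (hV : ∀ p ∈ V, Even (p.1 + p.2)) (hT : ∀ p ∈ T, Even (p.1 + p.2))
    (hv : v ∈ V) (hvT : v ∉ T) (hvS : v ∈ S) :
    tilingGF q (pathRegion V T S) =
      (if ((v.1 - 2, v.2) ∈ V ∨ (v.1 - 2, v.2) ∈ T) ∧ (v.1 - 2, v.2) ∉ S then
        tilingGF q (pathRegion (V.erase v) T (insert (v.1 - 2, v.2) (S.erase v))) else 0)
      + wtTwo q ((v.1, v.2 + 1), v) *
        (if ((v.1 - 1, v.2 + 1) ∈ V ∨ (v.1 - 1, v.2 + 1) ∈ T) ∧ (v.1 - 1, v.2 + 1) ∉ S then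
        tilingGF q (pathRegion (V.erase v) T (insert (v.1 - 1, v.2 + 1) (S.erase v))) else 0) := by
  obtain ⟨c, j⟩ := v
  have hev : Even (c + j) := hV _ hv
  have hD : ((c, j) : UnitTriangle) ∈ pathRegion V T S := by
    rw [mem_pathRegion]; left; exact hv
  have hup : ∀ t : UnitTriangle, Odd (t.1 + t.2) → (t ∈ pathRegion V T S ↔
      (((t.1 - 1, t.2) ∈ V ∨ (t.1 - 1, t.2) ∈ T) ∧ (t.1 - 1, t.2) ∉ S)) := by
    intro t ht
    rw [mem_pathRegion, or_iff_right]
    intro h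
    have := hV _ h
    grind
  have hfil : (regionLozenges (pathRegion V T S)).filter
      (fun L => L.1 = (c, j) ∨ L.2 = (c, j)) =
      ({((c - 1, j), (c, j)), ((c, j + 1), (c, j))} :
        Finset (UnitTriangle × UnitTriangle)).filter fun L => L.1 ∈ pathRegion V T S := by
    ext ⟨L1, L2⟩
    simp only [regionLozenges, Finset.mem_filter, Finset.mem_product, Finset.mem_singleton,
      IsLozenge, UnitTriangle.IsUp, Finset.mem_insert]
    constructor
    · rintro ⟨⟨⟨m1, m2⟩, hupL, hl⟩, rfl | rfl⟩
      · simp only at hupL; grind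
      · refine ⟨?_, m1⟩
        obtain ⟨a, b⟩ := L1
        simp only [Prod.mk.injEq] at hl ⊢
        rcases hl with hl | hl | hl
        · rw [hup _ hupL] at m1
          have : a - 1 = c := hl.1.symm
          simp only [this, ← hl.2] at m1
          exact absurd hvS m1.2
        · lia
        · lia
    · rintro ⟨h | h, m1⟩
      · obtain ⟨rfl, rfl⟩ := Prod.mk.injEq .. ▸ h
        exact ⟨⟨⟨m1, hD⟩, by simp only; grind, Or.inr (Or.inl (by simp))⟩, Or.inr rfl⟩
      · obtain ⟨rfl, rfl⟩ := Prod.mk.injEq .. ▸ h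
        exact ⟨⟨⟨m1, hD⟩, by simp only; grind, Or.inr (Or.inr (by simp))⟩, Or.inr rfl⟩
  rw [tilingGF_expand q _ hD, hfil, Finset.sum_filter, Finset.sum_pair (by simp)]
  have hw : wtTwo q ((c - 1, j), (c, j)) = 1 := if_neg (by simp only [Prod.mk.injEq]; lia)
  have e1 := pathRegion_sdiff (v' := (c - 2, j)) hV hT hv hvT hvS (by simp only; grind)
  have e2 := pathRegion_sdiff (v' := (c - 1, j + 1)) hV hT hv hvT hvS (by simp only; grind)
  have a1 : c - 2 + 1 = c - 1 := by ring
  have a2 : c - 1 - 1 = c - 2 := by ring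
  simp only [a1, sub_add_cancel] at e1 e2
  have m1 := hup (c - 1, j) (by simp only; grind)
  have m2 := hup (c, j + 1) (by simp only; grind)
  simp only [hw, one_mul, m1, m2, e1, e2, a2, mul_ite, mul_zero]

/-- End of the sweep: a strictly increasing self-map of `Fin n` is the identity, so each path
reaches the sink of its own index and the matrix becomes the identity. -/
theorem eq_of_strictMono_snd {n : ℕ} {s t : Fin n → ℤ × ℤ} (ht : StrictMono fun k => (t k).2)
    (ht1 : ∀ k, (t k).1 = -1) (hs : ∀ i, ∃ k, s i = t k)
    (hlex : ∀ i k, i < k → (s i).2 < (s k).2 ∨ ((s i).2 = (s k).2 ∧ (s i).1 < (s k).1)) :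
    s = t := by
  choose σ hσ using hs
  have hmono : StrictMono σ := by
    intro i k hik
    have := hlex i k hik
    rw [hσ i, hσ k, ht1, ht1] at this
    exact ht.lt_iff_lt.1 (by lia)
  have hid : σ = id := by
    refine hmono.range_inj strictMono_id |>.1 ?_
    rw [(Finite.injective_iff_surjective.1 hmono.injective).range_eq, Set.range_id]
  funext i
  rw [hσ i, hid, id]

/-- The Lindström–Gessel–Viennot determinant for the tilings of a region that is described by its
paths; `G` counts the paths from a vertex to the sinks. -/
theorem tilingGF_pathRegion_eq_det {K : Type*} [Field K] (q : K) {n : ℕ} (V₀ : Finset (ℤ × ℤ))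
    (t : Fin n → ℤ × ℤ) (G : ℤ × ℤ → Fin n → K)
    (hV₀ : ∀ p ∈ V₀, 0 ≤ p.1 ∧ Even (p.1 + p.2))
    (ht1 : ∀ k, (t k).1 = -1) (ht2 : ∀ k, Even ((t k).1 + (t k).2))
    (ht : StrictMono fun k => (t k).2)
    (hG : ∀ p ∈ V₀, G p = G (p.1 - 2, p.2) + wtTwo q ((p.1, p.2 + 1), p) • G (p.1 - 1, p.2 + 1))
    (hG1 : ∀ p ∈ V₀, (p.1 - 2, p.2) ∉ V₀ → (∀ k, (p.1 - 2, p.2) ≠ t k) → G (p.1 - 2, p.2) = 0)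
    (hG2 : ∀ p ∈ V₀, (p.1 - 1, p.2 + 1) ∉ V₀ → (∀ k, (p.1 - 1, p.2 + 1) ≠ t k) →
      G (p.1 - 1, p.2 + 1) = 0)
    (hGt : ∀ k l, G (t k) l = if k = l then 1 else 0)
    (V : Finset (ℤ × ℤ)) (hVV : V ⊆ V₀)
    (hup : ∀ p ∈ V₀, ∀ p' ∈ V, (p'.2 < p.2 ∨ (p'.2 = p.2 ∧ p.1 ≤ p'.1)) → p ∈ V)
    (s : Fin n → ℤ × ℤ) (hs : ∀ i, s i ∈ V ∨ ∃ k, s i = t k)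
    (hlex : ∀ i k, i < k → (s i).2 < (s k).2 ∨ ((s i).2 = (s k).2 ∧ (s i).1 < (s k).1))
    (hrow : ∀ i, ∀ p ∈ V, p.2 + 1 = (s i).2 → p.1 ≤ (s i).1 + 1) :
    tilingGF q (pathRegion V (Finset.univ.image t) (Finset.univ.image s)) =
      (Matrix.of fun i => G (s i)).det := by
  induction V using Finset.strongInduction generalizing s with
  | H V ih =>
  have hVe : ∀ p ∈ V, Even (p.1 + p.2) := fun p hp => (hV₀ p (hVV hp)).2
  have hTe : ∀ p ∈ Finset.univ.image t, Even (p.1 + p.2) := by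
    intro p hp
    obtain ⟨k, -, rfl⟩ := Finset.mem_image.1 hp
    exact ht2 k
  have hse : ∀ i, Even ((s i).1 + (s i).2) := by
    intro i
    rcases hs i with h | ⟨k, h⟩
    · exact hVe _ h
    · rw [h]; exact ht2 k
  rcases V.eq_empty_or_nonempty with rfl | hne
  · have hst : s = t := eq_of_strictMono_snd ht ht1 (fun i => by simpa using hs i) hlex
    subst hst
    have h1 : (Matrix.of fun i => G (s i)) = 1 := by
      ext k l
      rw [Matrix.of_apply, hGt, Matrix.one_apply]
    rw [h1, Matrix.det_one]
    simp [pathRegion, tilingGF_empty]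
  -- The sweep takes the rightmost vertex of the lowest row. Both possible predecessors of `v` come
  -- earlier in this order, so they are gone; `hup` says that `V` is a final segment of `V₀`.
  obtain ⟨v, hv, hmin⟩ := V.exists_min_image (fun p => toLex (p.2, -p.1)) hne
  replace hmin : ∀ p ∈ V, v.2 < p.2 ∨ (v.2 = p.2 ∧ p.1 ≤ v.1) := by
    intro p hp
    have := hmin p hp
    rw [Prod.Lex.toLex_le_toLex] at this
    simpa using this
  have hv0 := hV₀ v (hVV hv)
  have hvt : ∀ k, v ≠ t k := fun k e => by have := ht1 k; rw [← e] at this; lia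
  have hvT : v ∉ Finset.univ.image t := by simpa [eq_comm] using hvt
  have hss : V.erase v ⊂ V := Finset.erase_ssubset hv
  have hup' : ∀ p ∈ V₀, ∀ p' ∈ V.erase v, (p'.2 < p.2 ∨ (p'.2 = p.2 ∧ p.1 ≤ p'.1)) →
      p ∈ V.erase v := by
    intro p hp p' hp' h
    obtain ⟨hne', hp''⟩ := Finset.mem_erase.1 hp'
    refine Finset.mem_erase.2 ⟨?_, hup p hp p' hp'' h⟩
    rintro rfl
    have := hmin p' hp''
    exact hne' (Prod.ext (by lia) (by lia))
  by_cases hvs : ∀ i, s i ≠ v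
  · rw [tilingGF_pathRegion_erase q hVe hTe hv hvT (by simpa using hvs)]
    · refine ih _ hss ((Finset.erase_subset _ _).trans hVV) hup' s ?_ hlex ?_
      · exact fun i => (hs i).imp (fun h => Finset.mem_erase.2 ⟨hvs i, h⟩) id
      · exact fun i p hp => hrow i p (Finset.mem_of_mem_erase hp)
    · intro h; have := hmin _ h; simp only at this; lia
    · intro h; have := hmin _ h; simp only at this; lia
  push Not at hvs
  obtain ⟨i, rfl⟩ := hvs
  have hinj : Function.Injective s := by
    intro a b hab
    by_contra hne
    rcases lt_or_gt_of_ne hne with h | h <;> have := hlex _ _ h <;> rw [hab] at this <;> lia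
  -- One path step, treated alike for both directions. The order hypotheses say that the moved
  -- source overtakes no other source, so rows never need to be permuted and no signs arise.
  have hmove : ∀ v' : ℤ × ℤ, v' ≠ s i →
      ((s i).2 < v'.2 ∨ ((s i).2 = v'.2 ∧ v'.1 ≤ (s i).1)) →
      (v' ∉ V₀ → (∀ k, v' ≠ t k) → G v' = 0) →
      (∀ k, s k ≠ v' → k < i → (s k).2 < v'.2 ∨ ((s k).2 = v'.2 ∧ (s k).1 < v'.1)) →
      (∀ k, s k ≠ v' → i < k → v'.2 < (s k).2 ∨ (v'.2 = (s k).2 ∧ v'.1 < (s k).1)) →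
      (∀ p ∈ V, p.2 + 1 = v'.2 → p.1 ≤ v'.1 + 1) →
      (if (v' ∈ V ∨ v' ∈ Finset.univ.image t) ∧ v' ∉ Finset.univ.image s then
        tilingGF q (pathRegion (V.erase (s i)) (Finset.univ.image t)
          (insert v' ((Finset.univ.image s).erase (s i)))) else 0) =
      ((Matrix.of fun k => G (s k)).updateRow i (G v')).det := by
    intro v' hne' hafter hzero hlt hgt hrow'
    split_ifs with hc
    · obtain ⟨hc1, hc2⟩ := hc
      have hns : ∀ k, s k ≠ v' := by simpa using hc2
      have himg : insert v' ((Finset.univ.image s).erase (s i)) =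
          Finset.univ.image (Function.update s i v') := by
        ext p
        simp only [Finset.mem_insert, Finset.mem_erase, Finset.mem_image, Finset.mem_univ,
          true_and]
        constructor
        · rintro (rfl | ⟨h, k, rfl⟩)
          · exact ⟨i, by simp⟩
          · exact ⟨k, Function.update_of_ne (fun e => h (by rw [e])) _ _⟩
        · rintro ⟨k, rfl⟩
          by_cases hk : k = i
          · subst hk; simp
          · rw [Function.update_of_ne hk]
            exact Or.inr ⟨fun e => hk (hinj e), k, rfl⟩
      have hM : (Matrix.of fun k => G (s k)).updateRow i (G v') =
          Matrix.of fun k => G (Function.update s i v' k) := by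
        ext k l
        by_cases hk : k = i
        · subst hk; simp
        · simp [hk]
      rw [himg, hM]
      refine ih _ hss ((Finset.erase_subset _ _).trans hVV) hup' _ ?_ ?_ ?_
      · intro k
        by_cases hk : k = i
        · subst hk
          rw [Function.update_self]
          refine hc1.imp (fun h => Finset.mem_erase.2 ⟨hne', h⟩) fun h => ?_
          obtain ⟨l, -, hl⟩ := Finset.mem_image.1 h
          exact ⟨l, hl.symm⟩
        · rw [Function.update_of_ne hk]
          exact (hs k).imp (fun h => Finset.mem_erase.2 ⟨fun e => hk (hinj e), h⟩) id
      · intro a b hab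
        by_cases ha : a = i
        · subst ha
          rw [Function.update_self, Function.update_of_ne hab.ne']
          exact hgt b (hns b) hab
        · by_cases hb : b = i
          · subst hb
            rw [Function.update_self, Function.update_of_ne ha]
            exact hlt a (hns a) hab
          · rw [Function.update_of_ne ha, Function.update_of_ne hb]
            exact hlex a b hab
      · intro k p hp
        by_cases hk : k = i
        · subst hk
          rw [Function.update_self]
          exact hrow' p (Finset.mem_of_mem_erase hp)
        · rw [Function.update_of_ne hk]
          exact hrow k p (Finset.mem_of_mem_erase hp)
    · symm
      -- The step is impossible, so the determinant has to vanish: through two equal rows if another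
      -- source occupies `v'`, through a zero row if `v'` is neither a vertex nor a sink.
      by_cases hsv : ∃ k, s k = v'
      · obtain ⟨k, rfl⟩ := hsv
        have hk : k ≠ i := fun e => hne' (by rw [e])
        refine Matrix.det_zero_of_row_eq hk ?_
        rw [Matrix.updateRow_self, Matrix.updateRow_ne hk]
        rfl
      · push Not at hsv
        refine Matrix.det_eq_zero_of_row_eq_zero i fun l => ?_
        rw [Matrix.updateRow_self, hzero]
        · rfl
        · intro h
          exact hc ⟨Or.inl (hup v' h _ hv hafter), by simpa using hsv⟩
        · rintro k rfl
          exact hc ⟨Or.inr (by simp), by simpa using hsv⟩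
  have hdet : (Matrix.of fun k => G (s k)).det =
      ((Matrix.of fun k => G (s k)).updateRow i (G ((s i).1 - 2, (s i).2))).det +
      wtTwo q (((s i).1, (s i).2 + 1), s i) *
        ((Matrix.of fun k => G (s k)).updateRow i (G ((s i).1 - 1, (s i).2 + 1))).det := by
    rw [← Matrix.det_updateRow_smul, ← Matrix.det_updateRow_add, ← hG _ (hVV hv)]
    congr 1
    ext k l
    by_cases hk : k = i
    · subst hk; simp
    · simp [hk]
  rw [tilingGF_pathRegion_source q hVe hTe hv hvT (by simp), hdet]
  congr 1
  · refine hmove _ ?_ (Or.inr ⟨rfl, by simp⟩) (hG1 _ (hVV hv)) ?_ ?_ ?_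
    · intro e; have := congrArg Prod.fst e; simp at this
    · intro k hk hki
      have h1 := hlex k i hki
      -- By parity, vertices of one row are at least 2 apart, so a step of length 2 to the left can
      -- meet the next source but not pass it.
      have h2 := hse k
      have h3 := hse i
      rw [ne_eq, Prod.ext_iff] at hk
      simp only at hk ⊢
      grind
    · intro k hk hik
      have h1 := hlex i k hik
      simp only
      lia
    · intro p hp h
      have := hmin p hp
      simp only at h
      lia
  · congr 1
    refine hmove _ ?_ (Or.inl (by simp)) (hG2 _ (hVV hv)) ?_ ?_ ?_
    · intro e; have := congrArg Prod.fst e; simp at this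
    · intro k hk hki
      have h1 := hlex k i hki
      simp only
      lia
    · intro k hk hik
      have h1 := hlex i k hik
      -- A source one row up lies at abscissa at least `(s i).1 - 1`, hence the upward step lands on
      -- it or to its left.
      have h4 := hrow k (s i) hv
      rw [ne_eq, Prod.ext_iff] at hk
      simp only at hk ⊢
      have h5 : (s i).2 ≠ (s k).2 := by
        intro e
        rcases hs k with h | ⟨l, h⟩
        · have := hmin _ h; lia
        · have := ht1 l; rw [← h] at this; lia
      lia
    · intro p hp h
      have := hmin p hp
      simp only at h ⊢
      lia

/-! ### Balanced `q`-integers. -/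

/-- The balanced `q`-integer `(q ^ k - q ^ (-k)) / (q - q ^ (-1))`, extended by continuity to
`q = ± 1`. -/
noncomputable def balInt {K : Type*} [Field K] (q : K) (k : ℤ) : K :=
  open Classical in if q ^ 2 = 1 then k * q ^ (k - 1) else (q ^ k - q ^ (-k)) / (q - q⁻¹)

section balInt

variable {K : Type*} [Field K] {q : K}

theorem balInt_of_sq_eq_one (hq1 : q ^ 2 = 1) (k : ℤ) : balInt q k = k * q ^ (k - 1) :=
  if_pos hq1

theorem balInt_of_sq_ne_one (hq1 : q ^ 2 ≠ 1) (k : ℤ) :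
    balInt q k = (q ^ k - q ^ (-k)) / (q - q⁻¹) := if_neg hq1

theorem sub_inv_ne_zero_of_sq_ne_one (hq : q ≠ 0) (hq1 : q ^ 2 ≠ 1) : q - q⁻¹ ≠ 0 := by
  intro h
  apply hq1
  field_simp at h
  linear_combination h

theorem zpow_mul_self_of_sq_eq_one (hq1 : q ^ 2 = 1) (k : ℤ) : q ^ k * q ^ k = 1 := by
  rw [← mul_zpow, ← sq, hq1, one_zpow]

theorem zpow_neg_of_sq_eq_one (hq1 : q ^ 2 = 1) (k : ℤ) : q ^ (-k) = q ^ k := by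
  rw [zpow_neg]
  exact inv_eq_of_mul_eq_one_left (zpow_mul_self_of_sq_eq_one hq1 k)

theorem balInt_zero : balInt q 0 = 0 := by
  unfold balInt; split_ifs <;> simp

theorem balInt_one (hq : q ≠ 0) : balInt q 1 = 1 := by
  by_cases hq1 : q ^ 2 = 1
  · simp [balInt_of_sq_eq_one hq1]
  · rw [balInt_of_sq_ne_one hq1, zpow_one, zpow_neg_one,
      div_self (sub_inv_ne_zero_of_sq_ne_one hq hq1)]

theorem balInt_neg (k : ℤ) : balInt q (-k) = -balInt q k := by
  by_cases hq1 : q ^ 2 = 1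
  · rw [balInt_of_sq_eq_one hq1, balInt_of_sq_eq_one hq1,
      ← zpow_neg_of_sq_eq_one hq1 (-k - 1)]
    have : q ^ (-(-k - 1)) = q ^ (k - 1) := by
      have hq : q ≠ 0 := by rintro rfl; simp at hq1
      rw [show -(-k - 1) = (k - 1) + 2 by ring, zpow_add₀ hq]
      have : q ^ (2 : ℤ) = 1 := by exact_mod_cast hq1
      rw [this, mul_one]
    rw [this]; push_cast; ring
  · rw [balInt_of_sq_ne_one hq1, balInt_of_sq_ne_one hq1, neg_neg]
    ring

/-- This makes ⟨b - a⟩ the 2 × 2 determinant of (⟨a⟩, ⟨a - 1⟩) and (⟨b⟩, ⟨b - 1⟩), the only property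
of ⟨·⟩ that makes the later determinant evaluation work. -/
theorem balInt_mul_sub_mul (hq : q ≠ 0) (a b : ℤ) :
    balInt q a * balInt q (b - 1) - balInt q (a - 1) * balInt q b = balInt q (b - a) := by
  by_cases hq1 : q ^ 2 = 1
  · simp only [balInt_of_sq_eq_one hq1]
    have h2 : q ^ (2 : ℤ) = 1 := by exact_mod_cast hq1
    have e1 : q ^ (a - 1) * q ^ (b - 1 - 1) = q ^ (b - a - 1) := by
      rw [← zpow_add₀ hq, show a - 1 + (b - 1 - 1) = (b - a - 1) + 2 * (a - 1) by ring,
        zpow_add₀ hq, zpow_mul, h2, one_zpow, mul_one]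
    have e2 : q ^ (a - 1 - 1) * q ^ (b - 1) = q ^ (b - a - 1) := by
      rw [← e1, ← zpow_add₀ hq, ← zpow_add₀ hq]; congr 1; ring
    push_cast
    linear_combination (a : K) * (b - 1) * e1 - ((a : K) - 1) * b * e2
  · have h := sub_inv_ne_zero_of_sq_ne_one hq hq1
    simp only [balInt_of_sq_ne_one hq1, neg_sub, zpow_sub₀ hq, zpow_neg, zpow_one]
    have ha : q ^ a ≠ 0 := zpow_ne_zero _ hq
    have hb : q ^ b ≠ 0 := zpow_ne_zero _ hq
    rw [div_mul_div_comm, div_mul_div_comm, ← sub_div, div_eq_div_iff (mul_ne_zero h h) h]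
    field_simp
    ring

theorem balInt_add_one (hq : q ≠ 0) (c : ℤ) :
    balInt q (c + 1) = balInt q (c - 1) + (q ^ c + q ^ (-c)) := by
  by_cases hq1 : q ^ 2 = 1
  · simp only [balInt_of_sq_eq_one hq1, zpow_neg_of_sq_eq_one hq1]
    have h2 : q ^ (2 : ℤ) = 1 := by exact_mod_cast hq1
    have e1 : q ^ (c - 1 - 1) = q ^ c := by
      rw [show c - 1 - 1 = c - 2 by ring, zpow_sub₀ hq, h2, div_one]
    rw [e1, add_sub_cancel_right]
    push_cast
    ring
  · have h := sub_inv_ne_zero_of_sq_ne_one hq hq1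
    simp only [balInt_of_sq_ne_one hq1, neg_sub, neg_add, zpow_add₀ hq, zpow_sub₀ hq, zpow_neg,
      zpow_one]
    have ha : q ^ c ≠ 0 := zpow_ne_zero _ hq
    rw [div_add' _ _ _ h, div_left_inj' h]
    field_simp
    ring

/-- The recurrence of the path generating function at abscissa `c` with `b` vertical lozenges, after
cancelling the common factors. -/
theorem balInt_four_term (hq : q ≠ 0) (c b : ℤ) :
    balInt q (c + 1) * balInt q (c - 1 + b) = balInt q (c - 1) * balInt q (c + 1 - b) +
      (q ^ c + q ^ (-c)) * (balInt q c * balInt q b) := by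
  by_cases hq1 : q ^ 2 = 1
  · simp only [balInt_of_sq_eq_one hq1, zpow_neg_of_sq_eq_one hq1]
    have h2 : q ^ (2 : ℤ) = 1 := by exact_mod_cast hq1
    have hqq : q * q = 1 := by rw [← sq, hq1]
    have hi : q⁻¹ = q := inv_eq_of_mul_eq_one_left hqq
    have e1 : q ^ (-b) = q ^ b := zpow_neg_of_sq_eq_one hq1 b
    simp only [zpow_sub₀ hq, zpow_add₀ hq, zpow_one, div_eq_mul_inv, hi, ← zpow_neg, e1]
    push_cast
    linear_combination 2 * (c : K) * b * q ^ c * q ^ c * q ^ b * q ^ 2 * hqq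
  · have h := sub_inv_ne_zero_of_sq_ne_one hq hq1
    simp only [balInt_of_sq_ne_one hq1, neg_sub, neg_add, zpow_add₀ hq, zpow_sub₀ hq, zpow_neg,
      zpow_one]
    have ha : q ^ c ≠ 0 := zpow_ne_zero _ hq
    have hb : q ^ b ≠ 0 := zpow_ne_zero _ hq
    rw [div_mul_div_comm, div_mul_div_comm, div_mul_div_comm, ← mul_div_assoc, ← add_div,
      div_left_inj' (mul_ne_zero h h)]
    field_simp
    ring

theorem qInt_sq_eq (hq : q ≠ 0) (k : ℕ) : qInt (q ^ 2) k = q ^ ((k : ℤ) - 1) * balInt q k := by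
  rw [qInt, Int.toNat_natCast]
  by_cases hq1 : q ^ 2 = 1
  · rw [balInt_of_sq_eq_one hq1, hq1]
    have := zpow_mul_self_of_sq_eq_one hq1 ((k : ℤ) - 1)
    simp only [one_pow, Finset.sum_const, Finset.card_range, nsmul_eq_mul, mul_one, Int.cast_natCast]
    linear_combination -(k : K) * this
  · have h := sub_inv_ne_zero_of_sq_ne_one hq hq1
    rw [geom_sum_eq hq1, balInt_of_sq_ne_one hq1, zpow_sub₀ hq, zpow_neg, zpow_one, zpow_natCast,
      ← mul_div_assoc, div_eq_div_iff (sub_ne_zero.2 hq1) h]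
    field_simp
    ring

theorem balInt_ne_zero (hq : q ≠ 0) (hq_int : ∀ k : ℕ, 1 ≤ k → qInt (q ^ 2) k ≠ 0) {k : ℤ}
    (hk : 1 ≤ k) : balInt q k ≠ 0 := by
  lift k to ℕ using by lia
  have := hq_int k (by exact_mod_cast hk)
  rw [qInt_sq_eq hq] at this
  exact right_ne_zero_of_mul this

end balInt

/-! ### The generating function of a single path. -/

/-- The factorial that belongs to `balInt`. -/
noncomputable def balFact {K : Type*} [Field K] (q : K) (m : ℕ) : K :=
  ∏ k ∈ Finset.range m, balInt q (k + 1)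

/-- The generating function of the lattice paths from abscissa `c` to the west side with `B`
vertical lozenges. -/
noncomputable def pathGF {K : Type*} [Field K] (q : K) (c B : ℤ) : K :=
  if c < 0 then if c = -1 ∧ B = 0 then 1 else 0
  else if B < 0 then 0
  else if B = 0 then 1
  else (2 : K) ^ (-B) * balInt q (c + 1) *
    (∏ k ∈ Finset.range (B.toNat - 1), balInt q (c + 1 - B + 2 * (k + 1))) / balFact q B.toNat

section pathGF

variable {K : Type*} [Field K] {q : K}

theorem balFact_ne_zero (hq : q ≠ 0) (hq_int : ∀ k : ℕ, 1 ≤ k → qInt (q ^ 2) k ≠ 0) (m : ℕ) :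
    balFact q m ≠ 0 :=
  Finset.prod_ne_zero_iff.2 fun _ _ => balInt_ne_zero hq hq_int (by lia)

theorem pathGF_of_neg_left {c : ℤ} (hc : c < 0) (B : ℤ) :
    pathGF q c B = if c = -1 ∧ B = 0 then 1 else 0 := if_pos hc

theorem pathGF_of_neg_right (c : ℤ) {B : ℤ} (hB : B < 0) : pathGF q c B = 0 := by
  unfold pathGF; split_ifs <;> first | rfl | lia

theorem pathGF_zero_right {c : ℤ} (hc : -1 ≤ c) : pathGF q c 0 = 1 := by
  unfold pathGF; split_ifs <;> first | rfl | lia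

theorem pathGF_succ {c : ℤ} (hc : -1 ≤ c) (b : ℕ) :
    pathGF q c (b + 1) = (2 : K) ^ (-((b : ℤ) + 1)) * balInt q (c + 1) *
      (∏ k ∈ Finset.range b, balInt q (c - b + 2 * (k + 1))) / balFact q (b + 1) := by
  have h1 : ((b : ℤ) + 1).toNat = b + 1 := by lia
  unfold pathGF
  split_ifs with h2 h3 h4 h5
  · lia
  · rw [show c + 1 = 0 by lia, balInt_zero]; simp
  · lia
  · lia
  · rw [h1, add_sub_add_right_eq_sub, Nat.add_sub_cancel]

/-- The two terms are the two possible first steps. The parity condition is essential at `c = 0`: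
the closed formula is correct only on lattice vertices. -/
theorem pathGF_rec (h_two : (2 : K) ≠ 0) (hq : q ≠ 0)
    (hq_int : ∀ k : ℕ, 1 ≤ k → qInt (q ^ 2) k ≠ 0) {c B : ℤ} (hc : 0 ≤ c) (hcB : Odd (c + B)) :
    pathGF q c B = pathGF q (c - 2) B +
      (if c = 0 then 1 / 2 else (q ^ c + q ^ (-c)) / 2) * pathGF q (c - 1) (B - 1) := by
  rcases lt_trichotomy B 0 with hB | rfl | hB
  · simp [pathGF_of_neg_right _ hB, pathGF_of_neg_right _ (show B - 1 < 0 by lia)]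
  · have : c ≠ 0 := by rintro rfl; simp at hcB
    rw [pathGF_zero_right (by lia), pathGF_zero_right (by lia),
      pathGF_of_neg_right _ (show (0 : ℤ) - 1 < 0 by lia)]
    simp
  obtain ⟨b, rfl⟩ : ∃ b : ℕ, B = b + 1 := ⟨(B - 1).toNat, by lia⟩
  rw [add_sub_cancel_right]
  rcases eq_or_ne c 0 with rfl | hc0
  · rw [pathGF_succ (by lia), pathGF_of_neg_left (by lia), pathGF_of_neg_left (by lia),
      if_neg (by lia), if_pos rfl]
    rcases b with _ | b
    · simp [balFact, balInt_one hq, zpow_neg]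
    · obtain ⟨r, hr⟩ : ∃ r : ℕ, b = 2 * r + 1 := by
        obtain ⟨r, hr⟩ := hcB
        exact ⟨(r - 1).toNat, by lia⟩
      -- From the axis only one vertical lozenge can follow. For odd `B ≥ 3` the product contains
      -- ⟨0⟩, at index `r`.
      rw [if_neg (by lia), Finset.prod_eq_zero (i := r) (Finset.mem_range.2 (by lia))]
      · simp
      · rw [← balInt_zero (q := q)]; congr 1; lia
  · rw [if_neg hc0]
    rcases b with _ | b
    · have h1 := pathGF_succ (q := q) (c := c) (by lia) 0
      have h2 := pathGF_succ (q := q) (c := c - 2) (by lia) 0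
      rw [h1, h2, Nat.cast_zero, pathGF_zero_right (by lia), show c - 2 + 1 = c - 1 by ring,
        balInt_add_one hq]
      simp [balFact, balInt_one hq, zpow_neg]
      ring
    · have hf : balFact q (b + 1 + 1) = balFact q (b + 1) * balInt q (b + 2) := by
        rw [balFact, Finset.prod_range_succ, ← balFact]; push_cast; ring_nf
      have hf1 := balFact_ne_zero hq hq_int (b + 1)
      have hf2 : balInt q ((b : ℤ) + 2) ≠ 0 := balInt_ne_zero hq hq_int (by lia)
      have key := balInt_four_term hq c (b + 2)
      have h0 := pathGF_succ (q := q) (c := c - 1) (by lia) b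
      rw [pathGF_succ (by lia), pathGF_succ (by lia)]
      push_cast at h0 ⊢
      rw [h0, hf, Finset.prod_range_succ, Finset.prod_range_succ']
      set P := ∏ k ∈ Finset.range b, balInt q (c - 1 - b + 2 * (k + 1)) with hP
      have hP1 : ∏ k ∈ Finset.range b, balInt q (c - (b + 1) + 2 * (k + 1)) = P :=
        Finset.prod_congr rfl fun k _ => by congr 1; ring
      have hP2 : ∏ k ∈ Finset.range b, balInt q (c - 2 - (b + 1) + 2 * ((k + 1 : ℕ) + 1)) = P :=
        Finset.prod_congr rfl fun k _ => by congr 1; push_cast; ring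
      have h2 : (2 : K) ^ (-((b : ℤ) + 1)) = 2 * (2 : K) ^ (-((b : ℤ) + 1 + 1)) := by
        rw [show -((b : ℤ) + 1) = 1 + -((b : ℤ) + 1 + 1) by ring, zpow_add₀ h_two, zpow_one]
      have a1 : c - (b + 1) + 2 * (b + 1) = c - 1 + (b + 2) := by ring
      have a2 : c - 2 - (b + 1) + 2 * ((0 : ℕ) + 1) = c + 1 - (b + 2) := by push_cast; ring
      have a3 : c - 2 + 1 = c - 1 := by ring
      rw [hP1, hP2, h2, a1, a2, a3, sub_add_cancel]
      field_simp
      linear_combination P * key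

end pathGF

/-! ### The type C region as a path region. -/

/-- The vertices of the lattice paths in the halved hexagon. -/
noncomputable def hexagonVertices (x u n : ℕ) : Finset (ℤ × ℤ) :=
  (Finset.Icc (0 : ℤ) (2 * x + 2 * u) ×ˢ Finset.Ico (0 : ℤ) (2 * u)).filter fun p =>
    Even (p.1 + p.2) ∧ p.1 ≤ 2 * ((x : ℤ) + u - n) + p.2 ∧
      p.1 + p.2 + 2 ≤ 2 * ((x : ℤ) + u - n) + 2 * n

theorem mem_hexagonVertices {x u n : ℕ} {p : ℤ × ℤ} :
    p ∈ hexagonVertices x u n ↔ 0 ≤ p.1 ∧ 0 ≤ p.2 ∧ p.2 < 2 * u ∧ Even (p.1 + p.2) ∧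
      p.1 ≤ 2 * ((x : ℤ) + u - n) + p.2 ∧ p.1 + p.2 + 2 ≤ 2 * ((x : ℤ) + u - n) + 2 * n := by
  simp only [hexagonVertices, Finset.mem_filter, Finset.mem_product, Finset.mem_Icc,
    Finset.mem_Ico]
  constructor
  · tauto
  · rintro ⟨h1, h2, h3, h4, h5, h6⟩
    exact ⟨⟨⟨h1, by lia⟩, h2, h3⟩, h4, h5, h6⟩

/-- Down triangles are the vertices themselves. An up triangle on the axis belongs to a vertex at
abscissa -1, present exactly when it is a sink, that is, when its bump is kept. The vertices along
the southeast side have their up triangle outside the hexagon, so they are the sources. -/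
theorem typeCRegion_eq_pathRegion {x u n : ℕ} (hnu : n ≤ u) (h : Fin n → ℕ)
    (h_mem : ∀ i, 1 ≤ h i ∧ h i ≤ u) :
    typeCRegion x u h = pathRegion (hexagonVertices x u n)
      (Finset.univ.image fun k => ((-1 : ℤ), 2 * (h k : ℤ) - 1))
      (Finset.univ.image fun i : Fin n => (2 * ((x : ℤ) + u - n) + (i : ℤ), (i : ℤ))) := by
  ext ⟨c, j⟩
  simp only [mem_pathRegion, mem_hexagonVertices, typeCRegion, halvedHexagon, Finset.mem_sdiff,
    Finset.mem_filter, Finset.mem_product, Finset.mem_Icc, Finset.mem_Ico, Finset.mem_image,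
    Finset.mem_univ, true_and, Prod.mk.injEq, not_exists, not_and]
  rcases Int.even_or_odd (c + j) with hp | hp
  · constructor
    · rintro ⟨⟨⟨⟨h1, h2⟩, h3, h4⟩, h5, h6⟩, h7⟩
      exact Or.inl ⟨h1, h3, h4, hp, h5, by grind⟩
    · rintro (⟨h1, h2, h3, -, h5, h6⟩ | ⟨h1 | ⟨k, h1, h2⟩, h3⟩)
      · refine ⟨⟨⟨⟨h1, by lia⟩, h2, h3⟩, h5, by lia⟩, ?_⟩
        rintro k - hk
        grind
      · grind
      · grind
  · constructor
    · rintro ⟨⟨⟨⟨h1, h2⟩, h3, h4⟩, h5, h6⟩, h7⟩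
      refine Or.inr ⟨?_, fun i hi => by lia⟩
      rcases h1.eq_or_lt with rfl | h1
      · right
        obtain ⟨k, hk⟩ : ∃ k : ℕ, j = 2 * k - 1 := by
          obtain ⟨r, hr⟩ := hp
          exact ⟨(r + 1).toNat, by lia⟩
        by_contra hcon
        push Not at hcon
        refine h7 k ⟨by lia, fun i hi => hcon i (by simp) (by lia)⟩ rfl hk.symm
      · left
        refine ⟨by lia, h3, h4, by grind, by lia, by lia⟩
    · rintro (⟨h1, h2, h3, h4, h5, h6⟩ | ⟨⟨h1, h2, h3, h4, h5, h6⟩ | ⟨k, h1, h2⟩, h7⟩)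
      · grind
      · refine ⟨⟨⟨⟨by lia, by lia⟩, h2, h3⟩, ?_, by lia⟩, fun k _ hk => by lia⟩
        by_contra hcon
        have hc : c - 1 = 2 * ((x : ℤ) + u - n) + j := by grind
        exact h7 ⟨j.toNat, by lia⟩ (by simp only; lia) (by simp only; lia)
      · have := h_mem k
        refine ⟨⟨⟨⟨by lia, by lia⟩, by lia, by lia⟩, by lia, by lia⟩, ?_⟩
        rintro l ⟨-, hl⟩ - hl2
        exact hl k (by lia)

/-- The tiling generating function of the region as a determinant of path generating functions. -/
theorem tilingGF_typeCRegion_eq_det {K : Type*} [Field K] (q : K) (h_two : (2 : K) ≠ 0)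
    (hq : q ≠ 0) (hq_int : ∀ k : ℕ, 1 ≤ k → qInt (q ^ 2) k ≠ 0)
    {x u n : ℕ} (hnu : n ≤ u) (h : Fin n → ℕ) (h_mono : StrictMono h)
    (h_mem : ∀ i, 1 ≤ h i ∧ h i ≤ u) :
    tilingGF q (typeCRegion x u h) = (Matrix.of fun i k : Fin n =>
      pathGF q (2 * ((x : ℤ) + u - n) + (i : ℤ)) (2 * (h k : ℤ) - 1 - i)).det := by
  rw [typeCRegion_eq_pathRegion hnu h h_mem]
  refine tilingGF_pathRegion_eq_det q (hexagonVertices x u n) _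
    (fun p k => pathGF q p.1 (2 * (h k : ℤ) - 1 - p.2)) ?_ (fun _ => rfl) ?_ ?_ ?_ ?_ ?_ ?_ _
    subset_rfl (fun p hp _ _ _ => hp) _ ?_ ?_ ?_
  · intro p hp
    rw [mem_hexagonVertices] at hp
    exact ⟨hp.1, hp.2.2.2.1⟩
  · intro k
    simp only
    grind
  · intro a b hab
    have := h_mono hab
    simp only
    lia
  · intro p hp
    rw [mem_hexagonVertices] at hp
    obtain ⟨c, j⟩ := p
    funext k
    simp only at hp
    rw [pathGF_rec h_two hq hq_int hp.1 (by simp only; grind)]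
    simp only [wtTwo, add_sub_cancel_right, if_true, Pi.add_apply, Pi.smul_apply, smul_eq_mul]
    rw [show 2 * (h k : ℤ) - 1 - (j + 1) = 2 * (h k : ℤ) - 1 - j - 1 by ring]
  · intro p hp hp1 hp2
    rw [mem_hexagonVertices] at hp hp1
    funext k
    have h1 := hp2 k
    rw [ne_eq, Prod.ext_iff] at h1
    simp only at hp1 h1 ⊢
    rw [pathGF_of_neg_left (by grind), if_neg (by lia)]
    rfl
  · intro p hp hp1 hp2
    rw [mem_hexagonVertices] at hp hp1
    funext k
    have h1 := hp2 k
    have h2 := h_mem k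
    -- An upward step leaves the vertex set either through the west side, at abscissa -1, or above
    -- the top row, where the number of remaining vertical lozenges is negative.
    rw [ne_eq, Prod.ext_iff] at h1
    simp only at hp1 h1 ⊢
    by_cases hc : p.1 = 0
    · rw [pathGF_of_neg_left (by lia), if_neg (by lia)]
      rfl
    · rw [pathGF_of_neg_right _ (by grind)]
      rfl
  · intro k l
    rw [pathGF_of_neg_left (by lia)]
    refine if_congr ?_ rfl rfl
    have := h_mono.injective.eq_iff (a := k) (b := l)
    lia
  · intro i
    left
    rw [mem_hexagonVertices]
    have := i.2
    refine ⟨by simp only; lia, by simp only; lia, by simp only; lia, ?_, by simp only; lia,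
      by simp only; lia⟩
    simp only
    grind
  · intro i k hik
    left
    have : (i : ℕ) < k := hik
    simp only
    lia
  · intro i p hp hpi
    rw [mem_hexagonVertices] at hp
    simp only at hpi ⊢
    lia

/-! ### Krattenthaler's determinant. -/

theorem prod_Ioi_eq_prod_ite {M : Type*} [CommMonoid M] {n : ℕ} (f : Fin n → Fin n → M) :
    ∏ i, ∏ j ∈ Finset.Ioi i, f i j = ∏ i, ∏ j, if i < j then f i j else 1 := by
  refine Finset.prod_congr rfl fun i _ => ?_
  rw [← Finset.prod_filter]
  refine Finset.prod_congr ?_ fun _ _ => rfl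
  ext j
  simp

theorem prod_Ioi_castSucc {M : Type*} [CommMonoid M] {n : ℕ}
    (f : Fin (n + 1) → Fin (n + 1) → M) :
    ∏ i, ∏ j ∈ Finset.Ioi i, f i j =
      (∏ i : Fin n, ∏ j ∈ Finset.Ioi i, f i.castSucc j.castSucc) *
        ∏ i : Fin n, f i.castSucc (Fin.last n) := by
  rw [prod_Ioi_eq_prod_ite, prod_Ioi_eq_prod_ite, Fin.prod_univ_castSucc]
  have h : (∏ j, if Fin.last n < j then f (Fin.last n) j else 1) = 1 :=
    Finset.prod_eq_one fun j _ => if_neg (Fin.le_last j).not_gt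
  rw [h, mul_one, ← Finset.prod_mul_distrib]
  refine Finset.prod_congr rfl fun i _ => ?_
  rw [Fin.prod_univ_castSucc, if_pos (Fin.castSucc_lt_last i)]
  simp

/-- The determinant of two vectors of the plane. -/
def areaForm {K : Type*} [CommRing K] (v w : K × K) : K := v.1 * w.2 - v.2 * w.1

theorem areaForm_self {K : Type*} [CommRing K] (v : K × K) : areaForm v v = 0 := by
  unfold areaForm; ring

theorem areaForm_plucker {K : Type*} [CommRing K] (v w a b : K × K) :
    areaForm w b * areaForm v a - areaForm w a * areaForm v b = areaForm v w * areaForm a b := by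
  unfold areaForm; ring

/-- A homogeneous form of Krattenthaler's determinant lemma. -/
theorem det_prod_areaForm {K : Type*} [Field K] (n : ℕ) (v : Fin n → K × K) (a b : ℕ → K × K)
    (hvb : ∀ i : Fin n, ∀ r < (i : ℕ), areaForm (v i) (b r) ≠ 0) :
    (Matrix.of fun i j : Fin n => (∏ k ∈ Finset.Ico ((j : ℕ) + 1) n, areaForm (v i) (a k)) *
        ∏ r ∈ Finset.range j, areaForm (v i) (b r)).det =
      (∏ i, ∏ j ∈ Finset.Ioi i, areaForm (v i) (v j)) *
        ∏ k ∈ Finset.range n, ∏ r ∈ Finset.range k, areaForm (a k) (b r) := by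
  induction n generalizing a with
  | zero => simp
  | succ n ih =>
    set w := v (Fin.last n) with hw
    set M := Matrix.of fun i j : Fin (n + 1) =>
      (∏ k ∈ Finset.Ico ((j : ℕ) + 1) (n + 1), areaForm (v i) (a k)) *
        ∏ r ∈ Finset.range j, areaForm (v i) (b r)
    -- The bidiagonal `L` combines columns `j` and `j + 1` so that, by the Plücker relation,
    -- `areaForm (v i) w` splits off. This kills the last row outside the last column. What remains
    -- is the same determinant of size `n` with `a` shifted by one.
    let d : ℕ → K := fun j => if j < n then areaForm w (b j) else 1
    let L : Matrix (Fin (n + 1)) (Fin (n + 1)) K := Matrix.of fun k j =>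
      (if k = j then d j else 0) + if (k : ℕ) = j + 1 then -areaForm w (a (j + 1)) else 0
    have hLdet : L.det = ∏ r ∈ Finset.range n, areaForm w (b r) := by
      rw [Matrix.det_of_isLowerTriangular]
      · rw [Fin.prod_univ_castSucc, Finset.prod_range]
        simp [L, d]
      · intro k j hkj
        have : (k : ℕ) < j := hkj
        simp only [L, Matrix.of_apply]
        rw [if_neg (by rintro rfl; exact lt_irrefl _ this), if_neg (by lia), add_zero]
    have hlast : ∀ i, (M * L) i (Fin.last n) = ∏ r ∈ Finset.range n, areaForm (v i) (b r) := by
      intro i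
      rw [Matrix.mul_apply, Finset.sum_eq_single (Fin.last n)]
      · simp [L, d, M]
      · intro k _ hk
        have := k.2
        simp only [L, Matrix.of_apply, if_neg hk, Fin.val_last]
        rw [if_neg (by lia)]; simp
      · simp
    let g : Fin n → K × K → K := fun j p =>
      (∏ k ∈ Finset.Ico ((j : ℕ) + 1) n, areaForm p (a (k + 1))) *
        ∏ r ∈ Finset.range j, areaForm p (b r)
    have hg : ∀ (j : Fin n) p, g j p = (∏ k ∈ Finset.Ico ((j : ℕ) + 2) (n + 1), areaForm p (a k)) *
        ∏ r ∈ Finset.range j, areaForm p (b r) := by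
      intro j p
      simp only [g]
      rw [Finset.prod_Ico_add' (fun k => areaForm p (a k))]
    have hcol : ∀ i (j : Fin n), (M * L) i j.castSucc =
        areaForm (v i) w * (areaForm (a (j + 1)) (b j) * g j (v i)) := by
      intro i j
      have hs : ∀ k : Fin (n + 1), M i k * L k j.castSucc =
          (if k = j.castSucc then M i k * areaForm w (b j) else 0) +
          (if k = j.succ then M i k * -areaForm w (a (j + 1)) else 0) := by
        intro k
        have h1 : ((k : ℕ) = (j : ℕ) + 1) = (k = j.succ) := by simp [Fin.ext_iff]
        simp only [L, d, Matrix.of_apply, h1, Fin.val_castSucc, if_pos j.2, mul_add, mul_ite,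
          mul_zero]
      rw [Matrix.mul_apply, Finset.sum_congr rfl fun k _ => hs k, Finset.sum_add_distrib,
        Finset.sum_ite_eq' Finset.univ, Finset.sum_ite_eq' Finset.univ, hg,
        if_pos (Finset.mem_univ _), if_pos (Finset.mem_univ _)]
      simp only [M, Matrix.of_apply, Fin.val_castSucc, Fin.val_succ]
      rw [Finset.prod_eq_prod_Ico_succ_bot (by have := j.2; lia), Finset.prod_range_succ]
      linear_combination ((∏ k ∈ Finset.Ico ((j : ℕ) + 2) (n + 1), areaForm (v i) (a k)) *
        ∏ r ∈ Finset.range j, areaForm (v i) (b r)) *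
        areaForm_plucker (v i) w (a (j + 1)) (b j)
    have hN : (M * L).det = (∏ r ∈ Finset.range n, areaForm w (b r)) *
        ((∏ i : Fin n, areaForm (v i.castSucc) w) *
          ((∏ j : Fin n, areaForm (a (j + 1)) (b j)) *
            (Matrix.of fun i j : Fin n => g j (v i.castSucc)).det)) := by
      rw [Matrix.det_succ_row _ (Fin.last n), Fin.sum_univ_castSucc, Finset.sum_eq_zero, zero_add,
        hlast]
      · rw [← Matrix.det_mul_row, ← Matrix.det_mul_column]
        rw [Even.neg_one_pow ⟨_, rfl⟩, one_mul]
        congr 2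
        ext i j
        simp only [Matrix.submatrix_apply, Fin.succAbove_last, hcol, Matrix.of_apply]
      · intro j _
        rw [hcol, ← hw, areaForm_self]
        ring
    rw [Matrix.det_mul, hLdet, mul_comm] at hN
    -- The nonvanishing hypothesis serves only to cancel `L.det`.
    have hne : ∏ r ∈ Finset.range n, areaForm w (b r) ≠ 0 :=
      Finset.prod_ne_zero_iff.2 fun r hr => hvb (Fin.last n) r (by simpa using hr)
    rw [mul_left_cancel₀ hne hN]
    have hih := ih (fun i => v i.castSucc) (fun k => a (k + 1)) (fun i r hr => hvb i.castSucc r hr)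
    simp only [g]
    rw [hih, prod_Ioi_castSucc, Finset.prod_range_succ' _ n]
    simp only [Finset.prod_range_succ _ (_ : ℕ), Finset.prod_mul_distrib, Finset.range_zero,
      Finset.prod_empty, mul_one]
    rw [Finset.prod_range (fun j => areaForm (a (j + 1)) (b j))]
    ring

theorem areaForm_balInt {K : Type*} [Field K] {q : K} (hq : q ≠ 0) (a b : ℤ) :
    areaForm (balInt q a, balInt q (a - 1)) (balInt q b, balInt q (b - 1)) = balInt q (b - a) :=
  balInt_mul_sub_mul hq a b

theorem det_prod_balInt {K : Type*} [Field K] {q : K} (hq : q ≠ 0)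
    (hq_int : ∀ k : ℕ, 1 ≤ k → qInt (q ^ 2) k ≠ 0) (n : ℕ) (s : ℤ) (X : Fin n → ℤ)
    (hX : ∀ i : Fin n, (i : ℤ) < X i) :
    (Matrix.of fun i j : Fin n =>
        (∏ k ∈ Finset.Ico ((j : ℕ) + 1) n, balInt q (s + 2 * (k + 1) - X i)) *
        ∏ r ∈ Finset.range j, balInt q (X i - (r + 1))).det =
      (∏ i, ∏ j ∈ Finset.Ioi i, balInt q (X j - X i)) *
        ∏ k ∈ Finset.range n, ∏ r ∈ Finset.range k, balInt q (s + 2 * (k + 1) - (r + 1)) := by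
  have hb : ∀ c d : ℤ, areaForm (balInt q c, balInt q (c - 1))
      (-balInt q d, -balInt q (d - 1)) = balInt q (c - d) := by
    intro c d
    have := areaForm_balInt hq c d
    rw [← neg_sub d c, balInt_neg, ← this]
    unfold areaForm; ring
  -- The sign in the vectors `b r` turns ⟨(r + 1) - X⟩ into ⟨X - (r + 1)⟩.
  have := det_prod_areaForm n (fun i => (balInt q (X i), balInt q (X i - 1)))
    (fun k => (balInt q (s + 2 * (k + 1)), balInt q (s + 2 * (k + 1) - 1)))
    (fun r => (-balInt q ((r : ℤ) + 1), -balInt q ((r : ℤ) + 1 - 1))) ?_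
  · simpa only [areaForm_balInt hq, hb] using this
  · intro i r hr
    rw [hb]
    have := hX i
    exact balInt_ne_zero hq hq_int (by lia)

/-! ### Evaluation of the path determinant. -/

section evaluation

variable {K : Type*} [Field K] {q : K}

/-- The product `⟨2⟩⟨4⟩⋯⟨2m⟩` of balanced `q`-integers. -/
noncomputable def evenFact (q : K) (m : ℕ) : K := ∏ k ∈ Finset.range m, balInt q (2 * (k + 1))

theorem evenFact_ne_zero (hq : q ≠ 0) (hq_int : ∀ k : ℕ, 1 ≤ k → qInt (q ^ 2) k ≠ 0) (m : ℕ) :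
    evenFact q m ≠ 0 :=
  Finset.prod_ne_zero_iff.2 fun _ _ => balInt_ne_zero hq hq_int (by lia)

theorem evenFact_add (m l : ℕ) :
    evenFact q (m + l) = evenFact q m * ∏ k ∈ Finset.range l, balInt q (2 * (m + k + 1)) := by
  rw [evenFact, Finset.prod_range_add, ← evenFact]
  push_cast
  rfl

theorem balFact_add (m j : ℕ) :
    balFact q (m + j) = balFact q m * ∏ r ∈ Finset.range j, balInt q (m + j - r) := by
  rw [balFact, Finset.prod_range_add, ← balFact, ← Finset.prod_range_reflect]
  congr 1
  refine Finset.prod_congr rfl fun r hr => ?_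
  rw [Finset.mem_range] at hr
  congr 1
  lia

/-- Brings a matrix entry into Krattenthaler's form: the multiplier on the left depends on the sink
only, and on the right the factors before the last bracket depend on the source `j` or on the sink
`h` alone. -/
theorem pathGF_mul (h_two : (2 : K) ≠ 0) (hq : q ≠ 0)
    (hq_int : ∀ k : ℕ, 1 ≤ k → qInt (q ^ 2) k ≠ 0) {N n h j : ℕ} (hj : j < n) (h1 : 1 ≤ h)
    (hN : h ≤ N + n) :
    pathGF q (2 * N + j) (2 * h - 1 - j) * (evenFact q (N + n - h) * balFact q (2 * h - 1)) =
      2 ^ j * balInt q (2 * N + j + 1) * ((2 : K) ^ (-(2 * (h : ℤ) - 1)) * evenFact q (N + h - 1)) *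
      ((∏ k ∈ Finset.Ico (j + 1) n, balInt q (2 * N + 2 * (k + 1) - 2 * h)) *
        ∏ r ∈ Finset.range j, balInt q (2 * h - (r + 1))) := by
  -- The cases are the sign of the number of vertical lozenges. If it is negative, the sink lies
  -- below the source and the last product contains ⟨0⟩.
  rcases lt_trichotomy (2 * h - 1) j with hlt | heq | hgt
  · rw [pathGF_of_neg_right _ (by lia),
      Finset.prod_eq_zero (s := Finset.range j) (i := 2 * h - 1) (Finset.mem_range.2 hlt)]
    · simp
    · rw [← balInt_zero (q := q)]; congr 1; lia
  · rw [show 2 * (h : ℤ) - 1 - j = 0 by lia, pathGF_zero_right (by lia)]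
    have e1 : evenFact q (N + n - h) = evenFact q (N + h) *
        ∏ k ∈ Finset.Ico (j + 1) n, balInt q (2 * N + 2 * (k + 1) - 2 * h) := by
      rw [show N + n - h = N + h + (n - (j + 1)) by lia, evenFact_add,
        Finset.prod_Ico_eq_prod_range]
      congr 1
      refine Finset.prod_congr rfl fun k _ => ?_
      congr 1
      push_cast
      lia
    have e2 : evenFact q (N + h) = evenFact q (N + h - 1) * balInt q (2 * N + j + 1) := by
      rw [show N + h = N + h - 1 + 1 by lia, evenFact_add]
      simp only [Finset.prod_range_one, Nat.add_sub_cancel]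
      congr 2
      lia
    have e3 : balFact q (2 * h - 1) = ∏ r ∈ Finset.range j, balInt q (2 * h - (r + 1)) := by
      rw [heq, ← zero_add j, balFact_add]
      simp only [balFact, Finset.range_zero, Finset.prod_empty, one_mul, zero_add]
      refine Finset.prod_congr rfl fun r _ => ?_
      congr 1
      push_cast
      lia
    have e4 : (2 : K) ^ j * (2 : K) ^ (-(2 * (h : ℤ) - 1)) = 1 := by
      rw [show -(2 * (h : ℤ) - 1) = -(j : ℤ) by lia, zpow_neg, zpow_natCast]
      exact mul_inv_cancel₀ (pow_ne_zero _ h_two)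
    rw [e1, e2, e3]
    linear_combination -(balInt q (2 * N + j + 1) * evenFact q (N + h - 1) *
      ((∏ k ∈ Finset.Ico (j + 1) n, balInt q (2 * N + 2 * (k + 1) - 2 * h)) *
        ∏ r ∈ Finset.range j, balInt q (2 * h - (r + 1)))) * e4
  · obtain ⟨b, hb⟩ : ∃ b, 2 * h - 1 = b + 1 + j := ⟨2 * h - 2 - j, by lia⟩
    rw [show 2 * (h : ℤ) - 1 - j = b + 1 by lia, pathGF_succ (by lia)]
    have e4 : (2 : K) ^ (-((b : ℤ) + 1)) = 2 ^ j * (2 : K) ^ (-(2 * (h : ℤ) - 1)) := by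
      rw [← zpow_natCast, ← zpow_add₀ h_two]
      congr 1
      lia
    have e3 : balFact q (2 * h - 1) =
        balFact q (b + 1) * ∏ r ∈ Finset.range j, balInt q (2 * h - (r + 1)) := by
      rw [hb, balFact_add]
      congr 1
      refine Finset.prod_congr rfl fun r _ => ?_
      congr 1
      push_cast
      lia
    have hne := balFact_ne_zero hq hq_int (b + 1)
    have key : (∏ k ∈ Finset.range b, balInt q (2 * N + j - b + 2 * (k + 1))) *
        evenFact q (N + n - h) = evenFact q (N + h - 1) *
          ∏ k ∈ Finset.Ico (j + 1) n, balInt q (2 * N + 2 * (k + 1) - 2 * h) := by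
      -- With `A = N + j + 1 - h` nonnegative, both products are quotients of `evenFact` by
      -- `evenFact q A`; otherwise each of them contains ⟨0⟩.
      by_cases hA : h ≤ N + j + 1
      · obtain ⟨A, hA⟩ : ∃ A, N + j + 1 = A + h := ⟨N + j + 1 - h, by lia⟩
        rw [show N + n - h = A + (n - (j + 1)) by lia, show N + h - 1 = A + b by lia,
          evenFact_add, evenFact_add, Finset.prod_Ico_eq_prod_range]
        have p1 : ∏ k ∈ Finset.range b, balInt q (2 * N + j - b + 2 * (k + 1)) =
            ∏ k ∈ Finset.range b, balInt q (2 * (A + k + 1)) :=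
          Finset.prod_congr rfl fun k _ => by congr 1; lia
        have p2 : ∏ k ∈ Finset.range (n - (j + 1)),
            balInt q (2 * N + 2 * ((j + 1 + k : ℕ) + 1) - 2 * h) =
            ∏ k ∈ Finset.range (n - (j + 1)), balInt q (2 * (A + k + 1)) :=
          Finset.prod_congr rfl fun k _ => by congr 1; push_cast; lia
        rw [p1, p2]
        ring
      · rw [Finset.prod_eq_zero (s := Finset.range b) (i := h - N - j - 2)
          (Finset.mem_range.2 (by lia)),
          Finset.prod_eq_zero (s := Finset.Ico (j + 1) n) (i := h - N - 1)
          (Finset.mem_Ico.2 (by lia))]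
        · simp
        · rw [← balInt_zero (q := q)]; congr 1; lia
        · rw [← balInt_zero (q := q)]; congr 1; lia
    rw [e3, e4]
    field_simp
    linear_combination balInt q (2 * N + j + 1) *
      (∏ r ∈ Finset.range j, balInt q (2 * h - (r + 1))) * key

theorem succ_le_of_strictMono {n : ℕ} {h : Fin n → ℕ} (h_mono : StrictMono h)
    (h_pos : ∀ i, 1 ≤ h i) (i : Fin n) : (i : ℕ) + 1 ≤ h i := by
  obtain ⟨i, hi⟩ := i
  induction i with
  | zero => exact h_pos _
  | succ i ih =>
    have h1 := ih (by lia)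
    have h2 : h ⟨i, by lia⟩ < h ⟨i + 1, hi⟩ := h_mono (by simp)
    simp only at h1 ⊢
    lia

theorem tilingGF_typeCRegion_eq_prod (h_two : (2 : K) ≠ 0) (hq : q ≠ 0)
    (hq_int : ∀ k : ℕ, 1 ≤ k → qInt (q ^ 2) k ≠ 0) {x u n N : ℕ} (hN : N + n = x + u)
    (hnu : n ≤ u) (h : Fin n → ℕ) (h_mono : StrictMono h) (h_mem : ∀ i, 1 ≤ h i ∧ h i ≤ u) :
    tilingGF q (typeCRegion x u h) =
      (∏ j : Fin n, 2 ^ (j : ℕ) * balInt q (2 * N + (j : ℕ) + 1)) *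
      ((∏ k, (2 : K) ^ (-(2 * (h k : ℤ) - 1)) * evenFact q (N + h k - 1) /
          (evenFact q (N + n - h k) * balFact q (2 * h k - 1))) *
        ((∏ i, ∏ j ∈ Finset.Ioi i, balInt q (2 * (h j - h i))) *
          ∏ k ∈ Finset.range n, ∏ r ∈ Finset.range k,
            balInt q (2 * N + 2 * (k + 1) - (r + 1)))) := by
  rw [tilingGF_typeCRegion_eq_det q h_two hq hq_int hnu h h_mono h_mem]
  have hdet := det_prod_balInt hq hq_int n (2 * N) (fun k => 2 * (h k : ℤ)) (fun i => by
    have := succ_le_of_strictMono h_mono (fun i => (h_mem i).1) i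
    lia)
  simp only [← mul_sub] at hdet
  rw [← hdet, ← Matrix.det_transpose, ← Matrix.det_mul_column, ← Matrix.det_mul_row]
  congr 1
  ext k j
  have hk := h_mem k
  have hmul := pathGF_mul h_two hq hq_int j.2 hk.1 (show h k ≤ N + n by lia)
  have h1 := evenFact_ne_zero hq hq_int (N + n - h k)
  have h2 := balFact_ne_zero hq hq_int (2 * h k - 1)
  have hc : 2 * ((x : ℤ) + u - n) + (j : ℕ) = 2 * N + (j : ℕ) := by lia
  simp only [Matrix.transpose_apply, Matrix.of_apply, hc]
  rw [← mul_left_inj' (mul_ne_zero h1 h2), hmul]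
  field_simp

end evaluation

/-! ### Comparison with the stated product. -/

section product

variable {K : Type*} [Field K] {q : K}

theorem prod_zpow_eq_zpow_sum {ι : Type*} (hq : q ≠ 0) (s : Finset ι) (f : ι → ℤ) :
    ∏ i ∈ s, q ^ f i = q ^ ∑ i ∈ s, f i := by
  classical
  induction s using Finset.induction_on with
  | empty => simp
  | insert a s ha ih => rw [Finset.prod_insert ha, Finset.sum_insert ha, zpow_add₀ hq, ih]

theorem qInt_sq_eq_of_nonneg (hq : q ≠ 0) {k : ℤ} (hk : 0 ≤ k) :
    qInt (q ^ 2) k = q ^ (k - 1) * balInt q k := by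
  lift k to ℕ using hk
  exact qInt_sq_eq hq k

theorem prod_qInt_sq {ι : Type*} (hq : q ≠ 0) (s : Finset ι) (f : ι → ℤ)
    (hf : ∀ i ∈ s, 0 ≤ f i) :
    ∏ i ∈ s, qInt (q ^ 2) (f i) = q ^ (∑ i ∈ s, (f i - 1)) * ∏ i ∈ s, balInt q (f i) := by
  rw [← prod_zpow_eq_zpow_sum hq, ← Finset.prod_mul_distrib]
  exact Finset.prod_congr rfl fun i hi => qInt_sq_eq_of_nonneg hq (hf i hi)

theorem prod_prod_qInt_sq {ι κ : Type*} (hq : q ≠ 0) (s : Finset ι) (t : ι → Finset κ)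
    (f : ι → κ → ℤ) (hf : ∀ i ∈ s, ∀ j ∈ t i, 0 ≤ f i j) :
    ∏ i ∈ s, ∏ j ∈ t i, qInt (q ^ 2) (f i j) =
      q ^ (∑ i ∈ s, ∑ j ∈ t i, (f i j - 1)) * ∏ i ∈ s, ∏ j ∈ t i, balInt q (f i j) := by
  rw [← prod_zpow_eq_zpow_sum hq, ← Finset.prod_mul_distrib]
  exact Finset.prod_congr rfl fun i hi => prod_qInt_sq hq _ _ (hf i hi)

theorem two_mul_sum_range_cast (m : ℕ) : 2 * ∑ r ∈ Finset.range m, (r : ℤ) = m * (m - 1) := by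
  induction m with
  | zero => simp
  | succ m ih => rw [Finset.sum_range_succ, mul_add, ih]; push_cast; ring

theorem qFact_sq (hq : q ≠ 0) (m : ℕ) :
    qFact (q ^ 2) m = q ^ (∑ r ∈ Finset.range m, (r : ℤ)) * balFact q m := by
  have h : qFact (q ^ 2) m = ∏ i ∈ Finset.range m, qInt (q ^ 2) ((i : ℤ) + 1) := by
    rw [qFact]
    induction m with
    | zero => simp
    | succ m ih =>
      rw [Finset.prod_Icc_succ_top (by lia), ih, Finset.prod_range_succ]
      push_cast
      rfl
  rw [h, prod_qInt_sq hq _ _ fun _ _ => by lia, balFact]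
  simp

theorem consecSum_two_mul (a : ℤ) (k : ℕ) : 2 * consecSum (a + k - 1) a = k * (2 * a + k - 1) := by
  induction k with
  | zero => simp [consecSum]
  | succ k ih =>
    have h : Finset.Icc a (a + (k + 1 : ℕ) - 1) = insert (a + k) (Finset.Icc a (a + k - 1)) := by
      ext; simp; lia
    rw [consecSum, h, Finset.sum_insert (by simp), ← consecSum, mul_add, ih]
    push_cast
    ring

/-- A rearrangement of the `q`-integers that do not depend on the positions of the bumps. -/
theorem prod_Icc_prod_Icc_eq {M : Type*} [CommMonoid M] (n : ℕ) (f : ℤ → M) :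
    ∏ i ∈ Finset.Icc 1 ((n + 1) / 2), ∏ j ∈ Finset.Icc 1 (2 * n + 3 - 4 * i),
        f (2 * (i : ℤ) + j - 2) =
      ∏ k ∈ Finset.range n, (f (k + 1) * ∏ r ∈ Finset.range k, f (2 * (k + 1) - (r + 1))) := by
  have hrow : ∀ k : ℕ, f (k + 1) * ∏ r ∈ Finset.range k, f (2 * (k + 1) - (r + 1)) =
      ∏ l ∈ Finset.range (k + 1), f (k + 1 + l) := by
    intro k
    rw [Finset.prod_range_succ', mul_comm, ← Finset.prod_range_reflect]
    congr 1
    · refine Finset.prod_congr rfl fun r hr => ?_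
      rw [Finset.mem_range] at hr
      congr 1
      push_cast
      lia
  have hpairs : ∀ a : ℤ, ∀ m : ℕ, ∏ i ∈ Finset.Icc 1 m, (f (a - 2 * i) * f (a + 1 - 2 * i)) =
      ∏ l ∈ Finset.range (2 * m), f (a - 2 * m + l) := by
    intro a m
    induction m with
    | zero => simp
    | succ m ih =>
      rw [Finset.prod_Icc_succ_top (by lia), ih, show 2 * (m + 1) = 2 * m + 1 + 1 by ring,
        Finset.prod_range_succ', Finset.prod_range_succ', mul_assoc]
      congr 1
      · refine Finset.prod_congr rfl fun r hr => ?_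
        congr 1
        push_cast
        lia
      · rw [mul_comm]
        congr 2 <;> push_cast <;> lia
  induction n with
  | zero => simp
  | succ n ih =>
    -- On the left, row `i` runs over the arguments from `2 * i - 1` to `2 * n + 1 - 2 * i`. Raising
    -- `n` by one adds two arguments to every row, and for even `n` also a new row with the single
    -- argument `n + 1`; together these are `n + 1, …, 2 * n + 1`, the new row on the right.
    have hstep : ∀ i ∈ Finset.Icc 1 ((n + 1) / 2),
        ∏ j ∈ Finset.Icc 1 (2 * (n + 1) + 3 - 4 * i), f (2 * (i : ℤ) + j - 2) =
        (∏ j ∈ Finset.Icc 1 (2 * n + 3 - 4 * i), f (2 * (i : ℤ) + j - 2)) *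
          (f (2 * n + 2 - 2 * i) * f (2 * n + 2 + 1 - 2 * i)) := by
      intro i hi
      rw [Finset.mem_Icc] at hi
      rw [show 2 * (n + 1) + 3 - 4 * i = 2 * n + 3 - 4 * i + 1 + 1 by lia,
        Finset.prod_Icc_succ_top (by lia), Finset.prod_Icc_succ_top (by lia), mul_assoc]
      congr 3 <;> push_cast <;> lia
    rw [Finset.prod_range_succ, hrow, ← ih]
    rcases Nat.even_or_odd' n with ⟨m, rfl | rfl⟩
    · rw [show (2 * m + 1 + 1) / 2 = m + 1 by lia, Finset.prod_Icc_succ_top (by lia)]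
      rw [show (2 * m + 1) / 2 = m by lia] at hstep ⊢
      rw [Finset.prod_congr rfl hstep, Finset.prod_mul_distrib, hpairs, mul_assoc]
      congr 1
      rw [show 2 * (2 * m + 1) + 3 - 4 * (m + 1) = 1 by lia, Finset.Icc_self,
        Finset.prod_singleton, Finset.prod_range_succ', mul_comm]
      rw [mul_comm]
      congr 1
      · refine Finset.prod_congr rfl fun r hr => ?_
        congr 1
        push_cast
        lia
      · congr 1
        push_cast
        lia
    · rw [show (2 * m + 1 + 1 + 1) / 2 = m + 1 by lia]
      rw [show (2 * m + 1 + 1) / 2 = m + 1 by lia] at hstep ⊢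
      rw [Finset.prod_congr rfl hstep, Finset.prod_mul_distrib, hpairs]
      congr 1
      refine Finset.prod_congr rfl fun r hr => ?_
      congr 1
      push_cast
      lia

end product

section product

variable {K : Type*} [Field K] {q : K}

theorem prod_Icc_one_eq_prod_range {M : Type*} [CommMonoid M] (f : ℕ → M) (l : ℕ) :
    ∏ j ∈ Finset.Icc 1 l, f j = ∏ k ∈ Finset.range l, f (k + 1) := by
  induction l with
  | zero => simp
  | succ l ih => rw [Finset.prod_Icc_succ_top (by lia), ih, Finset.prod_range_succ]

theorem evenFact_mul_prod_Icc (m l : ℕ) :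
    evenFact q m * ∏ j ∈ Finset.Icc 1 l, balInt q (2 * ((m : ℤ) + j)) = evenFact q (m + l) := by
  rw [evenFact_add, prod_Icc_one_eq_prod_range (fun j : ℕ => balInt q (2 * ((m : ℤ) + j)))]
  congr 1

theorem evenFact_mul_prod_Icc_reflect (m l : ℕ) :
    evenFact q m * ∏ j ∈ Finset.Icc 1 l, balInt q (2 * ((m : ℤ) + l + 1 - j)) =
      evenFact q (m + l) := by
  rw [evenFact_add,
    prod_Icc_one_eq_prod_range (fun j : ℕ => balInt q (2 * ((m : ℤ) + l + 1 - j))),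
    ← Finset.prod_range_reflect]
  congr 1
  refine Finset.prod_congr rfl fun k hk => ?_
  rw [Finset.mem_range] at hk
  congr 1
  lia

/-- Each inner product is a quotient of two values of `evenFact`. The ends that do not involve `h`
cancel over all `i` by the reflection `Fin.rev`. -/
theorem prod_evenFact_eq (hq : q ≠ 0) (hq_int : ∀ k : ℕ, 1 ≤ k → qInt (q ^ 2) k ≠ 0)
    {n N : ℕ} (h : Fin n → ℕ) (h_le : ∀ i : Fin n, (i : ℕ) + 1 ≤ h i) (hN : ∀ i, h i ≤ N + n) :
    ∏ i : Fin n, ((∏ j ∈ Finset.Icc 1 (h i - (i + 1)), balInt q (2 * ((N : ℤ) + i + j))) *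
        ∏ j ∈ Finset.Icc 1 (h i - (i + 1)), balInt q (2 * ((N : ℤ) + n - i - j))) =
      ∏ i : Fin n, (evenFact q (N + h i - 1) / evenFact q (N + n - h i)) := by
  have hne := evenFact_ne_zero hq hq_int
  have h1 : ∀ i : Fin n,
      (∏ j ∈ Finset.Icc 1 (h i - (i + 1)), balInt q (2 * ((N : ℤ) + i + j))) *
        ∏ j ∈ Finset.Icc 1 (h i - (i + 1)), balInt q (2 * ((N : ℤ) + n - i - j)) =
      evenFact q (N + h i - 1) / evenFact q (N + n - h i) *
        (evenFact q (N + Fin.rev i) / evenFact q (N + i)) := by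
    intro i
    have hi := h_le i
    have hi' := hN i
    have e1 := evenFact_mul_prod_Icc (q := q) (N + i) (h i - (i + 1))
    have e2 := evenFact_mul_prod_Icc_reflect (q := q) (N + n - h i) (h i - (i + 1))
    rw [show N + (i : ℕ) + (h i - (i + 1)) = N + h i - 1 by lia] at e1
    rw [show N + n - h i + (h i - (i + 1)) = N + Fin.rev i by rw [Fin.val_rev]; lia] at e2
    have c1 : ((N + i : ℕ) : ℤ) = (N : ℤ) + i := by push_cast; rfl
    have c2 : ((N + n - h i : ℕ) : ℤ) + ((h i - (i + 1) : ℕ) : ℤ) + 1 = (N : ℤ) + n - i := by lia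
    rw [c1] at e1
    rw [c2] at e2
    rw [← e1, ← e2]
    have := hne (N + i)
    have := hne (N + n - h i)
    field_simp
  rw [Finset.prod_congr rfl fun i _ => h1 i, Finset.prod_mul_distrib, Finset.prod_div_distrib
    (f := fun i : Fin n => evenFact q (N + Fin.rev i)),
    show ∏ i : Fin n, evenFact q (N + Fin.rev i) = ∏ i : Fin n, evenFact q (N + i) from
      Equiv.prod_comp Fin.revPerm (fun i : Fin n => evenFact q (N + i)), div_self, mul_one]
  exact Finset.prod_ne_zero_iff.2 fun i _ => hne _

theorem sum_Ioi_sub_sub_one {n : ℕ} (h : Fin n → ℤ) :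
    ∑ i, ∑ j ∈ Finset.Ioi i, (2 * (h j - h i) - 1) =
      ∑ i : Fin n, ((2 * (2 * (i : ℤ) + 1 - n)) * h i - i) := by
  induction n with
  | zero => simp
  | succ n ih =>
    have := prod_Ioi_castSucc (M := Multiplicative ℤ)
      (fun i j => Multiplicative.ofAdd (2 * (h j - h i) - 1))
    have key : ∑ i, ∑ j ∈ Finset.Ioi i, (2 * (h j - h i) - 1) =
        (∑ i : Fin n, ∑ j ∈ Finset.Ioi i, (2 * (h j.castSucc - h i.castSucc) - 1)) +
          ∑ i : Fin n, (2 * (h (Fin.last n) - h i.castSucc) - 1) := this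
    rw [key, ih fun i => h i.castSucc, Fin.sum_univ_castSucc, ← Finset.sum_add_distrib]
    have h2 : ∀ i : Fin n, 2 * (2 * (i : ℤ) + 1 - n) * h i.castSucc - i +
        (2 * (h (Fin.last n) - h i.castSucc) - 1) =
        (2 * (2 * ((i.castSucc : ℕ) : ℤ) + 1 - (n + 1 : ℕ)) * h i.castSucc - (i.castSucc : ℕ)) +
          (2 * h (Fin.last n) - 1) := by
      intro i; rw [Fin.val_castSucc]; push_cast; ring
    rw [Finset.sum_congr rfl fun i _ => h2 i, Finset.sum_add_distrib]
    simp
    ring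

theorem sum_mul_sub_eq_zero (n : ℕ) :
    ∑ i ∈ Finset.range n, ((i : ℤ) + 1) * (3 * i - 2 * n + 2) = 0 := by
  have h : ∀ m : ℕ, ∑ i ∈ Finset.range m, ((i : ℤ) + 1) * (3 * i - 2 * n + 2) =
      m * (m + 1) * (m - n) := by
    intro m
    induction m with
    | zero => simp
    | succ m ih => rw [Finset.sum_range_succ, ih]; push_cast; ring
  rw [h, sub_self, mul_zero]

/-- The left side collects the powers of `q` from the numerator brackets, the right side `E'` and
the powers from the factorials. The sides do not agree term by term in `i`: the discrepancy, free of
`h` and `N`, only sums to zero (`sum_mul_sub_eq_zero`). -/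
theorem expE_balance {n N : ℕ} (h : Fin n → ℕ) (h_le : ∀ i : Fin n, (i : ℕ) + 1 ≤ h i) :
    (∑ i : Fin n, ∑ j ∈ Finset.Ioi i, (2 * ((h j : ℤ) - h i) - 1)) +
      (∑ k ∈ Finset.range n, ((2 * (N : ℤ) + k + 1 - 1) +
        ∑ r ∈ Finset.range k, (2 * (N : ℤ) + 2 * (k + 1) - (r + 1) - 1))) +
      (∑ i : Fin n, ((∑ j ∈ Finset.Icc 1 (h i - (i + 1)), (2 * ((N : ℤ) + i + j) - 1)) +
        ∑ j ∈ Finset.Icc 1 (h i - (i + 1)), (2 * ((N : ℤ) + n - i - j) - 1))) =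
    (∑ i : Fin n, consecSum (2 * (N : ℤ) + i) (2 * N - 2 * h i + 2 * (i + 1))) +
      ∑ i : Fin n, ∑ r ∈ Finset.range (2 * h i - 1), (r : ℤ) := by
  rw [sum_Ioi_sub_sub_one (fun i => (h i : ℤ)), Finset.sum_range]
  refine mul_left_cancel₀ (two_ne_zero' ℤ) ?_
  have hz : ∑ i : Fin n, ((i : ℤ) + 1) * (3 * i - 2 * n + 2) = 0 := by
    rw [← sum_mul_sub_eq_zero n, Finset.sum_range]
  rw [← sub_eq_zero, ← mul_sub, ← Finset.sum_add_distrib, ← Finset.sum_add_distrib,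
    ← Finset.sum_add_distrib, ← Finset.sum_sub_distrib, Finset.mul_sum]
  trans ∑ i : Fin n, 2 * (((i : ℤ) + 1) * (3 * i - 2 * n + 2))
  · refine Finset.sum_congr rfl fun i _ => ?_
    have hi := h_le i
    have s1 : 2 * ∑ r ∈ Finset.range (i : ℕ), (2 * (N : ℤ) + 2 * ((i : ℕ) + 1) - (r + 1) - 1) =
        2 * (i * (2 * (N : ℤ) + 2 * i)) - i * (i - 1) := by
      rw [← two_mul_sum_range_cast, ← mul_sub]
      have : ∀ r : ℕ, 2 * (N : ℤ) + 2 * ((i : ℕ) + 1) - (r + 1) - 1 = (2 * (N : ℤ) + 2 * i) - r :=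
        fun r => by ring
      simp only [this, Finset.sum_sub_distrib, Finset.sum_const, Finset.card_range, nsmul_eq_mul]
    have s2 : (∑ j ∈ Finset.Icc 1 (h i - (i + 1)), (2 * ((N : ℤ) + i + j) - 1)) +
        ∑ j ∈ Finset.Icc 1 (h i - (i + 1)), (2 * ((N : ℤ) + n - i - j) - 1) =
        ((h i : ℤ) - (i + 1)) * (4 * N + 2 * n - 2) := by
      rw [← Finset.sum_add_distrib]
      have : ∀ j : ℕ, 2 * ((N : ℤ) + i + j) - 1 + (2 * ((N : ℤ) + n - i - j) - 1) =
          4 * N + 2 * n - 2 := fun j => by ring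
      simp only [this, Finset.sum_const, Nat.card_Icc, nsmul_eq_mul]
      congr 1
      lia
    have s3 : 2 * consecSum (2 * (N : ℤ) + i) (2 * N - 2 * h i + 2 * (i + 1)) =
        (2 * h i - i - 1) * (4 * N - 2 * h i + 3 * i + 2) := by
      have := consecSum_two_mul (2 * N - 2 * h i + 2 * (i + 1)) (2 * h i - i - 1)
      have c : ((2 * h i - i - 1 : ℕ) : ℤ) = 2 * h i - i - 1 := by lia
      rw [c] at this
      rw [show (2 * (N : ℤ) + i) = 2 * N - 2 * h i + 2 * (i + 1) + (2 * h i - i - 1) - 1 by ring,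
        this]
      ring
    have s4 := two_mul_sum_range_cast (2 * h i - 1)
    have c : ((2 * h i - 1 : ℕ) : ℤ) = 2 * h i - 1 := by lia
    rw [c] at s4
    linear_combination s1 + 2 * s2 - s3 - s4
  · rw [← Finset.mul_sum, hz, mul_zero]

/-- The condition on `X` covers `n < u` and `n = u` at once: the product sees `X` only through `X -
e'`, and in both cases the shifted parameter is `N - 1`. -/
theorem qProductQ_eq_prod (h_two : (2 : K) ≠ 0) (hq : q ≠ 0)
    (hq_int : ∀ k : ℕ, 1 ≤ k → qInt (q ^ 2) k ≠ 0) {x u n N : ℕ} (hN : N + n = x + u)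
    (X : ℤ) (hX : X - eQ u (0 : ℕ) (0 : ℕ) n = x - 1) (h : Fin n → ℕ) (h_mono : StrictMono h)
    (h_mem : ∀ i, 1 ≤ h i ∧ h i ≤ u) :
    qProductQ q X u 0 ![] h =
      (∏ j : Fin n, 2 ^ (j : ℕ) * balInt q (2 * N + (j : ℕ) + 1)) *
      ((∏ k, (2 : K) ^ (-(2 * (h k : ℤ) - 1)) * evenFact q (N + h k - 1) /
          (evenFact q (N + n - h k) * balFact q (2 * h k - 1))) *
        ((∏ i, ∏ j ∈ Finset.Ioi i, balInt q (2 * (h j - h i))) *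
          ∏ k ∈ Finset.range n, ∏ r ∈ Finset.range k,
            balInt q (2 * N + 2 * (k + 1) - (r + 1)))) := by
  have h_le := succ_le_of_strictMono h_mono fun i => (h_mem i).1
  have hy : X + u - n + (0 : ℕ) - (0 : ℕ) - eQ u (0 : ℕ) (0 : ℕ) n = (N : ℤ) - 1 := by lia
  have hE : expE X u 0 (![] : Fin 0 → ℕ) h =
      ∑ i : Fin n, consecSum (2 * (N : ℤ) + i) (2 * N - 2 * h i + 2 * (i + 1)) := by
    simp only [expE, fQ, Finset.univ_eq_empty, Finset.sum_empty, Nat.cast_zero, mul_zero,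
      zero_mul, Int.zero_ediv, zero_add]
    rw [Nat.cast_zero] at hX
    refine Finset.sum_congr rfl fun i _ => ?_
    congr 1 <;> lia
  have hF : (2 : K) ^ (-expF (![] : Fin 0 → ℕ) h) =
      (∏ j : Fin n, (2 : K) ^ (j : ℕ)) * ∏ k, (2 : K) ^ (-(2 * (h k : ℤ) - 1)) := by
    rw [← Finset.prod_mul_distrib]
    simp only [← zpow_natCast, ← zpow_add₀ h_two]
    rw [prod_zpow_eq_zpow_sum h_two]
    simp only [expF, Finset.univ_eq_empty, Finset.sum_empty, Nat.cast_zero, mul_zero, zero_add]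
    rw [← Finset.sum_neg_distrib]
    congr 1
    refine Finset.sum_congr rfl fun i _ => ?_
    ring
  have hV := prod_prod_qInt_sq hq Finset.univ (fun i : Fin n => Finset.Ioi i)
    (fun i j => 2 * ((h j : ℤ) - h i)) (fun i _ j hj => by
      have := h_mono (Finset.mem_Ioi.1 hj)
      lia)
  have hC : ∏ i ∈ Finset.Icc 1 ((n + 1) / 2), ∏ j ∈ Finset.Icc 1 (2 * n + 3 - 4 * i),
      qInt (q ^ 2) (2 * ((N : ℤ) - 1) + 2 * i + j) =
      q ^ (∑ k ∈ Finset.range n, ((2 * (N : ℤ) + k + 1 - 1) +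
        ∑ r ∈ Finset.range k, (2 * (N : ℤ) + 2 * (k + 1) - (r + 1) - 1))) *
      ((∏ j : Fin n, balInt q (2 * N + (j : ℕ) + 1)) * ∏ k ∈ Finset.range n, ∏ r ∈ Finset.range k,
            balInt q (2 * N + 2 * (k + 1) - (r + 1))) := by
    have h1 := prod_Icc_prod_Icc_eq n (fun z => qInt (q ^ 2) (2 * N + z))
    have h2 : ∀ i j : ℕ, 2 * (N : ℤ) + (2 * (i : ℤ) + j - 2) = 2 * ((N : ℤ) - 1) + 2 * i + j :=
      fun i j => by ring
    simp only [h2] at h1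
    rw [h1, ← Finset.prod_range (fun j => balInt q (2 * (N : ℤ) + (j : ℕ) + 1)),
      ← prod_zpow_eq_zpow_sum hq, ← Finset.prod_mul_distrib, ← Finset.prod_mul_distrib]
    refine Finset.prod_congr rfl fun k _ => ?_
    have h3 := prod_qInt_sq hq (Finset.range k)
      (fun r => 2 * (N : ℤ) + 2 * (k + 1) - (r + 1)) (fun r hr => by
        rw [Finset.mem_range] at hr
        lia)
    have h4 : ∀ r : ℕ, 2 * (N : ℤ) + (2 * (k + 1) - (r + 1)) = 2 * N + 2 * (k + 1) - (r + 1) :=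
      fun r => by ring
    simp only [h4]
    rw [h3, ← add_assoc, qInt_sq_eq_of_nonneg hq (by lia), zpow_add₀ hq]
    ring
  have hD : ∏ i : Fin n, ∏ j ∈ Finset.Icc 1 (h i - (i + 1)),
      qInt (q ^ 2) (2 * ((N : ℤ) - 1 + ((i : ℤ) + 1) + j + (0 : ℕ))) *
        qInt (q ^ 2) (2 * ((N : ℤ) - 1 - ((i : ℤ) + 1) - j + n + 2)) =
      q ^ (∑ i : Fin n, ((∑ j ∈ Finset.Icc 1 (h i - (i + 1)), (2 * ((N : ℤ) + i + j) - 1)) +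
        ∑ j ∈ Finset.Icc 1 (h i - (i + 1)), (2 * ((N : ℤ) + n - i - j) - 1))) *
      ∏ i : Fin n, (evenFact q (N + h i - 1) / evenFact q (N + n - h i)) := by
    rw [← prod_evenFact_eq hq hq_int h h_le (fun i => by have := h_mem i; lia),
      ← prod_zpow_eq_zpow_sum hq, ← Finset.prod_mul_distrib]
    refine Finset.prod_congr rfl fun i _ => ?_
    have h1 := prod_qInt_sq hq (Finset.Icc 1 (h i - (i + 1))) (fun j => 2 * ((N : ℤ) + i + j))
      fun _ _ => by lia
    have h2 := prod_qInt_sq hq (Finset.Icc 1 (h i - (i + 1))) (fun j => 2 * ((N : ℤ) + n - i - j))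
      fun j hj => by
        have := h_mem i
        rw [Finset.mem_Icc] at hj
        lia
    have e1 : ∀ j : ℕ, 2 * ((N : ℤ) - 1 + ((i : ℤ) + 1) + j + (0 : ℕ)) = 2 * ((N : ℤ) + i + j) :=
      fun j => by push_cast; ring
    have e2 : ∀ j : ℕ, 2 * ((N : ℤ) - 1 - ((i : ℤ) + 1) - j + n + 2) =
      2 * ((N : ℤ) + n - i - j) := fun j => by ring
    simp only [e1, e2]
    rw [Finset.prod_mul_distrib, h1, h2, zpow_add₀ hq]
    ring
  have hB : ∏ j : Fin n, qFact (q ^ 2) (2 * h j - 1) =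
      q ^ (∑ i : Fin n, ∑ r ∈ Finset.range (2 * h i - 1), (r : ℤ)) *
        ∏ j : Fin n, balFact q (2 * h j - 1) := by
    rw [← prod_zpow_eq_zpow_sum hq, ← Finset.prod_mul_distrib]
    exact Finset.prod_congr rfl fun i _ => qFact_sq hq _
  have hbal := congrArg (q ^ ·) (expE_balance (N := N) h h_le)
  simp only [zpow_add₀ hq] at hbal
  have hBne : ∏ j : Fin n, balFact q (2 * h j - 1) ≠ 0 :=
    Finset.prod_ne_zero_iff.2 fun i _ => balFact_ne_zero hq hq_int _
  have hGne : ∏ j : Fin n, evenFact q (N + n - h j) ≠ 0 :=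
    Finset.prod_ne_zero_iff.2 fun i _ => evenFact_ne_zero hq hq_int _
  have hI : Finset.Icc 1 0 = (∅ : Finset ℕ) := rfl
  simp only [qProductQ, hy, hE, hF, hC, hD, hB, hV, hI, Finset.univ_eq_empty, Finset.prod_empty,
    Finset.prod_const_one, one_mul, mul_one]
  simp only [Finset.prod_mul_distrib, Finset.prod_div_distrib, zpow_neg q]
  have hz1 := zpow_ne_zero (∑ i : Fin n, ∑ r ∈ Finset.range (2 * h i - 1), (r : ℤ)) hq
  have hz2 := zpow_ne_zero
    (∑ i : Fin n, consecSum (2 * (N : ℤ) + i) (2 * N - 2 * h i + 2 * (i + 1))) hq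
  generalize q ^ (∑ i : Fin n, ∑ r ∈ Finset.range (2 * h i - 1), (r : ℤ)) = z1 at *
  generalize q ^ (∑ i : Fin n, consecSum (2 * (N : ℤ) + i) (2 * N - 2 * h i + 2 * (i + 1))) = z2
    at *
  generalize q ^ (∑ i : Fin n, ∑ j ∈ Finset.Ioi i, (2 * ((h j : ℤ) - h i) - 1)) = z3 at *
  generalize q ^ (∑ k ∈ Finset.range n, ((2 * (N : ℤ) + k + 1 - 1) +
    ∑ r ∈ Finset.range k, (2 * (N : ℤ) + 2 * (k + 1) - (r + 1) - 1))) = z4 at *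
  generalize q ^ (∑ i : Fin n,
    ((∑ j ∈ Finset.Icc 1 (h i - (i + 1)), (2 * ((N : ℤ) + i + j) - 1)) +
      ∑ j ∈ Finset.Icc 1 (h i - (i + 1)), (2 * ((N : ℤ) + n - i - j) - 1))) = z5 at *
  -- All powers of `q` together, `z2` being `q ^ E'` and `z1` the part from the factorials.
  have hz : z2⁻¹ * (z3 / z1) * z4 * z5 = 1 := by
    field_simp
    linear_combination hbal
  generalize (∏ j : Fin n, (2 : K) ^ (j : ℕ)) = A
  generalize (∏ k, (2 : K) ^ (-(2 * (h k : ℤ) - 1))) = T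
  generalize (∏ j : Fin n, balFact q (2 * h j - 1)) = B at *
  generalize (∏ j : Fin n, evenFact q (N + n - h j)) = G at *
  trans (z2⁻¹ * (z3 / z1) * z4 * z5) * (A * T * (∏ j : Fin n, balInt q (2 * N + (j : ℕ) + 1)) *
    ((∏ j : Fin n, evenFact q (N + h j - 1)) / (G * B)) *
    (∏ i, ∏ j ∈ Finset.Ioi i, balInt q (2 * (h j - h i))) * ∏ k ∈ Finset.range n,
      ∏ r ∈ Finset.range k, balInt q (2 * N + 2 * (k + 1) - (r + 1)))
  · field_simp
  · rw [hz]
    field_simp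

end product

theorem mainTheorem9 {K : Type*} [Field K] (q : K) (h_two : (2 : K) ≠ 0) (hq : q ≠ 0)
    (hq_int : ∀ k : ℕ, 1 ≤ k → qInt (q ^ 2) k ≠ 0)
    (x u n : ℕ) (hnu : n ≤ u) (h : Fin n → ℕ) (h_mono : StrictMono h)
    (h_mem : ∀ i, 1 ≤ h i ∧ h i ≤ u) :
    (n < u → tilingGF q (typeCRegion x u h) = qProductQ q x u 0 ![] h) ∧
    (n = u → tilingGF q (typeCRegion x u h) = qProductQ q ((x : ℤ) - 1) u 0 ![] h) := by
  have hN : x + u - n + n = x + u := by lia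
  rw [tilingGF_typeCRegion_eq_prod h_two hq hq_int hN hnu h h_mono h_mem]
  constructor
  · intro hlt
    refine (qProductQ_eq_prod h_two hq hq_int hN _ ?_ h h_mono h_mem).symm
    -- Here `e' = 1`; for `n = u` below, `e' = 0`, which the argument `x - 1` compensates.
    rw [eQ, min_eq_right (by lia)]
    lia
  · intro heq
    refine (qProductQ_eq_prod h_two hq hq_int hN _ ?_ h h_mono h_mem).symm
    rw [eQ, min_eq_left (by lia)]
    lia
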